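/- **Interrupt timed automata.** An interrupt timed automaton (ITA) with $n$ levels consists of a finite alphabet $\Sigma$; a finite set $Q$ of states with an initial state $q_0$, a set $Q_f\subseteq Q$ of final states and a level map $\lambda:Q\to\{1,\dots,n\}$; a finite set of clocks $X=\biguplus_{i=1}^n X_i$, where $X_i=\{x_i\}\uplus Y_i$ consists of a main clock $x_i$ and auxiliary clocks $Y_i$; an active clock $\mathrm{act}(q)\in X_{\lambda(q)}$ for each state $q$; and a finite set $\Delta$ of transitions $q\xrightarrow{\varphi,a,u}q'$ with $a\in\Sigma\cup\{\varepsilon\}$. For $k=\lambda(q)$, $k'=\lambda(q')$, the guard $\varphi$ is a finite conjunction of conditions $C\bowtie 0$, $\bowtie\in\{>,\ge,=,\le,<\}$, where $C$ is either a linear expression with rational coefficients over the main clocks $x_i$ ($i<k$) and at most one clock of $X_k$, or $C=z-z'$ with $z,z'\in X_k$. The update $u$ leaves the clocks of levels $>k$ unchanged, sets the clocks of levels $i$ with $k'<i\le k$ to $0$, and assigns to each $z\in X_i$ with $i\le\min(k,k')$ an expression $C_z$ which is $z$ itself, or $\sum_{j<i}a_jx_j+b$ with rational coefficients, or, provided that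 $z\in Y_i$ or $i=k=k'$, a clock $z'\in X_i$. We write $C[u]$ for the result of simultaneously substituting every clock $z$ in $C$ by the expression that $u$ assigns to it. **Semantics.** A configuration is a pair $(q,v)$ with $q\in Q$, $v\in\mathbb R^X$; the initial one is $(q_0,\mathbf 0)$. A time step of duration $d\ge 0$ adds $d$ to the clock $\mathrm{act}(q)$ and changes nothing else; a discrete step $(q,v)\to(q',v[u])$ by a transition $q\xrightarrow{\varphi,a,u}q'$ is possible if $v\models\varphi$, where $v[u](z)$ is the value of $C_z$ under $v$ for every assignment $z:=C_z$ of $u$, and $v[u](z)=v(z)$ for the other clocks. A run labelled $d_1a_1\cdots d_ma_m$ ($m\ge0$) alternates time steps and discrete steps; it is accepting if it leads from $(q_0,\mathbf 0)$ to a configuration with state in $Q_f$. It yields the timed word $(a_1,d_1)(a_2,d_1+d_2)\cdots(a_m,d_1+\dots+d_m)$ with the pairs with $a_i=\varepsilon$ removed. The untimed language is the set of the projections on $\Sigma^*$ of these timed words. **Saturated sets.** For a linear expression $C$ and a clock $z$ with coefficient $a$ in $C$, normalize $C$ with respect to $z$ by dividing it by $a$ if $a\ne0$ and leaving it unchanged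 if $a=0$; write the result as $\alpha z+D$ with $\alpha\in\{0,1\}$ and $D$ not containing $z$, and put $\mathrm{b}(C,z)=-D$. Let $(E_k)_{1\le k\le n}$ be the least family of sets of expressions such that: (i) $X_k\cup\{0\}\subseteq E_k$; (ii) if $C\bowtie0$ occurs in a guard of a transition leaving a state of level $k$ and $C$ is a linear expression over $z\in X_k$ and the main clocks of levels $<k$, then $\mathrm{b}(C,z)\in E_k$; (iii) if $u$ is the update of a transition $q\to q'$ with $\lambda(q)\ge k$ and $\lambda(q')\ge k$ and $C\in E_k$, then $C[u]\in E_k$; (iv) if $u$ is the update of a transition $q\to q'$ with $\ell=\lambda(q)<k\le\lambda(q')$ and $C\neq C'$ are in $E_k$, then $\mathrm{b}(D,x_\ell)\in E_\ell$, where $D$ is $C[u]-C'[u]$ with all clocks of levels $>\ell$ replaced by $0$. **Class automaton.** A class is a pair $R=(q,(\preceq_k)_{k\le\lambda(q)})$ with $q\in Q$ and $\preceq_k$ a total preorder on $E_k$. Let $[\![R]\!]$ be the set of configurations $(q,v)$ such that all clocks of levels $>\lambda(q)$ have value $0$ and, for all $k\le\lambda(q)$ and $g,h\in E_k$, $v(g)\le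 v(h)$ iff $g\preceq_k h$. There is a discrete edge $R\xrightarrow{e}R'$, $e\in\Delta$, if some $s\in[\![R]\!]$ has a discrete step by $e$ to some $s'\in[\![R']\!]$. There is a time edge $R\xrightarrow{succ}R'$ if $R'$ has the same state $q$ and the same preorders at levels $<\lambda(q)$ as $R$, and $\preceq'_{\lambda(q)}$ is obtained from $\preceq_{\lambda(q)}$ as follows: if the equivalence class of $\mathrm{act}(q)$ is not a singleton, $\mathrm{act}(q)$ is moved just above the rest of it; if it is a singleton but not the greatest equivalence class, it is merged with the next equivalence class; otherwise nothing changes. A class is initial if $(q_0,\mathbf 0)\in[\![R]\!]$ and final if its state is in $Q_f$. An edge $e$ is labelled by the action of the transition $e$; time edges are silent. **Theorem.** For every interrupt timed automaton (with auxiliary clocks) $\mathcal A$: 1. the untimed language of $\mathcal A$ is regular; 2. all the sets $E_k$ are finite, so that there are finitely many classes, and there is exactly one initial class; 3. the relation $\{((q,v),R)\mid (q,v)\in[\![R]\!]\}$ is a time-abstract bisimulation between the transition system of $\mathcal A$ and the class automaton, that is, a bisimulation where discrete steps by $e$ correspond to edges $\xrightarrow{e}$ and time steps of arbitrary duration correspond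 to finite, possibly empty, sequences of time edges; the initial configuration and the initial class are related; 4. the class automaton accepts the untimed language of $\mathcal A$. Moreover the class automaton can be built effectively: there is an algorithm which, given (the code of) an ITA $\mathcal A$, halts and outputs a finite list of classes (each given by its state and by the pairs of its preorders on the sets $E_k$) containing every class accessible from the initial one, together with the initial class, the final classes and all the time edges and discrete edges between the listed classes. -/

import Mathlib

/-! Interrupt timed automata with auxiliary clocks: syntax, semantics, saturated sets of
expressions, class automaton, and finite encodings. -/

/-- Clocks partitioned by the levels `Fin n`: the clocks of level `i` are the main clock
`⟨i, none⟩` and the auxiliary clocks `⟨i, some y⟩` with `y : Y i`. -/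
abbrev Clock {n : ℕ} (Y : Fin n → Type*) := Σ i : Fin n, Option (Y i)

/-- Linear expressions `∑ x, a x * x + b` over `X` with rational coefficients, as pairs `(a, b)`;
sum, difference and scaling are those of the product vector space. -/
abbrev LinExpr (X : Type*) := (X → ℚ) × ℚ

namespace LinExpr

open Classical in
/-- The expression consisting of the single clock `x`. -/
noncomputable def var {X : Type*} (x : X) : LinExpr X := (Pi.single x 1, 0)

/-- The value of an expression under a valuation. -/
noncomputable def eval {X : Type*} [Fintype X] (v : X → ℝ) (C : LinExpr X) : ℝ :=
  ∑ x, (C.1 x : ℝ) * v x + (C.2 : ℝ)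

/-- `C[u]`: simultaneous substitution of every `x` by `u x`. -/
def subst {X : Type*} [Fintype X] (u : X → LinExpr X) (C : LinExpr X) : LinExpr X :=
  ∑ x, C.1 x • u x + (0, C.2)

/-- Normalization with respect to `z`: if the coefficient of `z` is nonzero, divide by it. -/
def normalize {X : Type*} (C : LinExpr X) (z : X) : LinExpr X :=
  if C.1 z = 0 then C else (C.1 z)⁻¹ • C

open Classical in
/-- If the normalization of `C` with respect to `z` is `α z + ∑ a x + b` with `α ∈ {0, 1}`, this is
`-∑ a x - b`, the expression with which `α z` has to be compared. -/
noncomputable def bound {X : Type*} (C : LinExpr X) (z : X) : LinExpr X :=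
  -(Function.update (C.normalize z).1 z 0, (C.normalize z).2)

/-- `C` is a linear expression over the main clocks of level `< i`. -/
def OverMainBelow {n : ℕ} {Y : Fin n → Type*} (i : Fin n) (C : LinExpr (Clock Y)) : Prop :=
  ∀ z, C.1 z ≠ 0 → z.1 < i ∧ z.2 = none

/-- `C` is a linear expression over the main clocks of level `< k` and the clock `y` of
level `k`. -/
def OverMainBelowAnd {n : ℕ} {Y : Fin n → Type*} (k : Fin n) (y : Option (Y k))
    (C : LinExpr (Clock Y)) : Prop :=
  ∀ z, C.1 z ≠ 0 → z = ⟨k, y⟩ ∨ (z.1 < k ∧ z.2 = none)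

/-- `C` with all clocks of level `> l` replaced by `0` (their value in a state of level `l`). -/
def truncate {n : ℕ} {Y : Fin n → Type*} (l : Fin n) (C : LinExpr (Clock Y)) :
    LinExpr (Clock Y) :=
  (fun z => if z.1 ≤ l then C.1 z else 0, C.2)

end LinExpr

/-- The comparison operators `>, ≥, =, ≤, <`. -/
inductive Cmp where
  | gt | ge | eq | le | lt

/-- `c.holds r` is `r ⋈ 0`. -/
def Cmp.holds : Cmp → ℝ → Prop
  | gt, r => r > 0
  | ge, r => r ≥ 0
  | eq, r => r = 0
  | le, r => r ≤ 0
  | lt, r => r < 0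

/-- A transition. The guard is a conjunction of atoms `C ⋈ 0`. The action `none` is the empty
word. The update maps each clock to the expression assigned to it; a clock `z` that is not
assigned is mapped to `var z`. -/
structure Transition (Act Q X : Type*) where
  src : Q
  guard : List (LinExpr X × Cmp)
  action : Option Act
  update : X → LinExpr X
  tgt : Q

/-- The expressions allowed in guards at level `k`: linear expressions over the main clocks of
lower levels and at most one clock of level `k`, or the difference of two clocks of level `k`. -/
def GuardExpr {n : ℕ} {Y : Fin n → Type*} (k : Fin n) (C : LinExpr (Clock Y)) : Prop :=
  (∃ y, C.OverMainBelowAnd k y) ∨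
    ∃ y y' : Option (Y k), C = LinExpr.var ⟨k, y⟩ - LinExpr.var ⟨k, y'⟩

/-- The assignments `z := C` allowed in a transition from level `k` to level `k'`. -/
def UpdateAllowed {n : ℕ} {Y : Fin n → Type*} (k k' : Fin n) (z : Clock Y)
    (C : LinExpr (Clock Y)) : Prop :=
  if z.1 ≤ k ∧ z.1 ≤ k' then
    C = LinExpr.var z ∨ C.OverMainBelow z.1 ∨
      ((z.2 ≠ none ∨ (z.1 = k ∧ k = k')) ∧ ∃ y' : Option (Y z.1), C = LinExpr.var ⟨z.1, y'⟩)
  else if z.1 ≤ k then C = 0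
  else C = LinExpr.var z

/-- Interrupt timed automata with `n` levels, alphabet `Act`, set of states `Q` and sets `Y i` of
auxiliary clocks. The active clock of `q` is the clock `act q` of level `level q`. -/
structure ITA (Act Q : Type*) {n : ℕ} (Y : Fin n → Type*) where
  init : Q
  final : Set Q
  level : Q → Fin n
  act : (q : Q) → Option (Y (level q))
  trans : List (Transition Act Q (Clock Y))
  guard_ok : ∀ e ∈ trans, ∀ c ∈ e.guard, GuardExpr (level e.src) c.1
  update_ok : ∀ e ∈ trans, ∀ z, UpdateAllowed (level e.src) (level e.tgt) z (e.update z)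

/-- A relation between the states of two labelled transition systems is a bisimulation. -/
def IsBisimulation {S T L : Type*} (stepS : L → S → S → Prop) (stepT : L → T → T → Prop)
    (r : S → T → Prop) : Prop :=
  ∀ s t, r s t →
    (∀ l s', stepS l s s' → ∃ t', stepT l t t' ∧ r s' t') ∧
    (∀ l t', stepT l t t' → ∃ s', stepS l s s' ∧ r s' t')

/-- The time successor of a total preorder `le` when the value of `a` alone increases.
If the equivalence class of `a` is not a singleton, `a` is placed just above the rest of it.
Otherwise `a` is merged with the next equivalence class, if there is one. -/
def postLE {α : Type*} (le : α → α → Prop) (a f g : α) : Prop :=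
  ((∃ h, h ≠ a ∧ le h a ∧ le a h) ∧ (le f g ∧ ¬ (f = a ∧ g ≠ a ∧ le g a))) ∨
  ((¬ ∃ h, h ≠ a ∧ le h a ∧ le a h) ∧
    (le f g ∨ (g = a ∧ ¬ le f a ∧ ∀ h, ¬ le h a → le f h)))

namespace ITA

section Semantics

variable {Act Q : Type*} {n : ℕ} {Y : Fin n → Type*}

/-- Configurations: a state and a clock valuation. -/
abbrev Config (_A : ITA Act Q Y) := Q × (Clock Y → ℝ)

/-- The initial configuration: initial state, all clocks zero. -/
def initConfig (A : ITA Act Q Y) : A.Config := (A.init, fun _ => 0)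

/-- The active clock of a state. -/
def actClock (A : ITA Act Q Y) (q : Q) : Clock Y := ⟨A.level q, A.act q⟩

open Classical in
/-- Time step of duration `d`: only the active clock evolves. -/
def TimeStep (A : ITA Act Q Y) (d : ℝ) (s s' : A.Config) : Prop :=
  0 ≤ d ∧
    s' = (s.1, Function.update s.2 (A.actClock s.1) (s.2 (A.actClock s.1) + d))

variable [∀ i, Fintype (Y i)]

/-- Discrete step for the transition of index `e`. -/
def DiscreteStep (A : ITA Act Q Y) (e : Fin A.trans.length) (s s' : A.Config) : Prop :=
  s.1 = A.trans[e].src ∧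
  (∀ c ∈ A.trans[e].guard, c.2.holds (c.1.eval s.2)) ∧
  s' = (A.trans[e].tgt, fun z => (A.trans[e].update z).eval s.2)

/-- Runs with label `d₁ a₁ d₂ a₂ … dₘ aₘ`, an alternation of time steps and discrete steps. -/
inductive Run (A : ITA Act Q Y) : A.Config → List (ℝ × Option Act) → A.Config → Prop
  | nil (s : A.Config) : Run A s [] s
  | cons {s s₁ s₂ s' : A.Config} {d : ℝ} {e : Fin A.trans.length} {l : List (ℝ × Option Act)} :
      A.TimeStep d s s₁ → A.DiscreteStep e s₁ s₂ → Run A s₂ l s' →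
      Run A s ((d, A.trans[e].action) :: l) s'

/-- The timed word of a run label read from date `t` on: actions with their dates, without the
empty actions. -/
def timedWord : ℝ → List (ℝ × Option Act) → List (Act × ℝ)
  | _, [] => []
  | t, (d, none) :: l => timedWord (t + d) l
  | t, (d, some a) :: l => (a, t + d) :: timedWord (t + d) l

/-- The timed words of the accepting runs. -/
def timedLanguage (A : ITA Act Q Y) : Set (List (Act × ℝ)) :=
  {w | ∃ l s, A.Run A.initConfig l s ∧ s.1 ∈ A.final ∧ w = timedWord 0 l}

/-- The untimed language: projection of the timed language on the actions. -/
def untimedLanguage (A : ITA Act Q Y) : Language Act :=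
  {w | ∃ t ∈ A.timedLanguage, w = t.map Prod.fst}

/-- The steps of the transition system with durations forgotten: `none` labels time steps,
`some e` labels the discrete steps of the transition `e`. -/
def abstractStep (A : ITA Act Q Y) :
    Option (Fin A.trans.length) → A.Config → A.Config → Prop
  | none => fun s s' => ∃ d, A.TimeStep d s s'
  | some e => A.DiscreteStep e

/-- `A.Saturated k C` says that `C` belongs to the set `E_k` of the least family that contains
the clocks of level `k` and `0` in `E_k` and is closed under the saturation rules. -/
inductive Saturated (A : ITA Act Q Y) : Fin n → LinExpr (Clock Y) → Prop
  | clock (k : Fin n) (y : Option (Y k)) : Saturated A k (LinExpr.var ⟨k, y⟩)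
  | zero (k : Fin n) : Saturated A k 0
  /-- An atom of a guard at level `k`, normalized to `α z + ∑ a x + b ⋈ 0`: add `-∑ a x - b`. -/
  | guard {e : Transition Act Q (Clock Y)} {c : LinExpr (Clock Y) × Cmp}
      (y : Option (Y (A.level e.src))) :
      e ∈ A.trans → c ∈ e.guard → c.1.OverMainBelowAnd (A.level e.src) y →
      Saturated A (A.level e.src) (c.1.bound ⟨A.level e.src, y⟩)
  /-- A transition between states of level at least `k`: close `E_k` under its update. -/
  | update {k : Fin n} {e : Transition Act Q (Clock Y)} {C : LinExpr (Clock Y)} :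
      e ∈ A.trans → k ≤ A.level e.src → k ≤ A.level e.tgt →
      Saturated A k C → Saturated A k (C.subst e.update)
  /-- A transition from level `l < k` to a level at least `k`: for distinct `C, C'` in `E_k`,
  normalize `C[u] - C'[u]` to `α x + ∑ a x + b`, with `x` the main clock of level `l`, and add
  `-∑ a x - b` to `E_l`. -/
  | cross {k : Fin n} {e : Transition Act Q (Clock Y)} {C C' : LinExpr (Clock Y)} :
      e ∈ A.trans → A.level e.src < k → k ≤ A.level e.tgt →
      Saturated A k C → Saturated A k C' → C ≠ C' →
      Saturated A (A.level e.src)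
        (((C.subst e.update - C'.subst e.update).truncate (A.level e.src)).bound
          ⟨A.level e.src, none⟩)

/-- The saturated set of expressions of level `k`. -/
def E (A : ITA Act Q Y) (k : Fin n) : Set (LinExpr (Clock Y)) := {C | A.Saturated k C}

/-- The states of the class automaton: a control state `q` together with a total preorder on
`E_k` for every level `k` up to the level of `q`. -/
structure Class (A : ITA Act Q Y) where
  state : Q
  le : (k : Fin n) → k ≤ A.level state → A.E k → A.E k → Prop
  le_total : ∀ k hk f g, le k hk f g ∨ le k hk g f
  le_trans : ∀ k hk f g h, le k hk f g → le k hk g h → le k hk f h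

namespace Class

variable {A : ITA Act Q Y}

/-- The configurations described by a class. The clocks of levels above the level of the state
are not yet activated and have value `0`. -/
def sem (R : A.Class) : Set A.Config :=
  {s | s.1 = R.state ∧ (∀ z : Clock Y, A.level s.1 < z.1 → s.2 z = 0) ∧
    ∀ k hk (f g : A.E k), LinExpr.eval s.2 f.1 ≤ LinExpr.eval s.2 g.1 ↔ R.le k hk f g}

/-- Edge of the class automaton for the transition `e`. -/
def DiscreteEdge (e : Fin A.trans.length) (R R' : A.Class) : Prop :=
  ∃ s ∈ R.sem, ∃ s' ∈ R'.sem, A.DiscreteStep e s s'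

/-- `R'` is the time successor of `R`: the preorders of the levels below the level of the state
are kept, and at the level of the state the active clock moves one step up. -/
def TimeSucc (R R' : A.Class) : Prop :=
  R'.state = R.state ∧
  (∀ k (hk : k ≤ A.level R.state) (hk' : k ≤ A.level R'.state) (f g : A.E k),
    k < A.level R.state → (R'.le k hk' f g ↔ R.le k hk f g)) ∧
  ∀ (hk' : A.level R.state ≤ A.level R'.state) (f g : A.E (A.level R.state)),
    R'.le _ hk' f g ↔
      postLE (R.le _ le_rfl)
        ⟨LinExpr.var (A.actClock R.state), Saturated.clock _ (A.act R.state)⟩ f g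

/-- The edges of the class automaton: `none` labels time successors, `some e` labels discrete
edges of the transition `e`. -/
def edge : Option (Fin A.trans.length) → A.Class → A.Class → Prop
  | none => TimeSucc
  | some e => DiscreteEdge e

/-- The steps of the class automaton: an abstract time step is a finite, possibly empty, sequence
of time successors. -/
def abstractStep : Option (Fin A.trans.length) → A.Class → A.Class → Prop
  | none => Relation.ReflTransGen TimeSucc
  | some e => DiscreteEdge e

/-- Classes that are accessible in the class automaton from the class of the initial
configuration. -/
def Accessible (R : A.Class) : Prop :=
  ∃ R₀ : A.Class, A.initConfig ∈ R₀.sem ∧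
    Relation.ReflTransGen (fun R₁ R₂ => ∃ l, edge l R₁ R₂) R₀ R

end Class

/-- The class automaton, as an automaton over the alphabet of `A` with silent moves: time
successors and discrete edges of transitions without action are silent. -/
def classAutomaton (A : ITA Act Q Y) : εNFA Act A.Class where
  step R a := {R' | (a = none ∧ R.TimeSucc R') ∨
    ∃ e : Fin A.trans.length, A.trans[e].action = a ∧ Class.DiscreteEdge e R R'}
  start := {R | A.initConfig ∈ R.sem}
  accept := {R | R.state ∈ A.final}

end Semantics

end ITA

/-! Finite encodings, used to express that the class automaton is built by an algorithm. -/

/-- A rational number as a fraction. -/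
abbrev RatCode := ℤ × ℕ

/-- An expression: for each level the list of coefficients of its clocks (main clock first), and
the constant. -/
abbrev LinCode := List (List RatCode) × RatCode

/-- A transition: source, guard, action, update, target. -/
abbrev TransitionCode := ℕ × List (LinCode × ℕ) × Option ℕ × List (List LinCode) × ℕ

/-- An automaton: size of the alphabet, number of states, numbers of auxiliary clocks per level,
initial state, final states, levels of the states, active clocks of the states, transitions. -/
abbrev ITACode :=
  ℕ × ℕ × List ℕ × ℕ × List Bool × List ℕ × List ℕ × List TransitionCode

/-- A class: the control state and, for each level, the list of the pairs `(f, g)` with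
`f ≼ g`. -/
abbrev ClassCode := ℕ × List (List (LinCode × LinCode))

/-- A finite class automaton: states, initial state, final states and edges, each labelled by
`none` (time successor) or by the index of a transition. -/
abbrev ClassAutomatonCode :=
  List ClassCode × ClassCode × List ClassCode × List (ClassCode × Option ℕ × ClassCode)

/-- The fraction in lowest terms. -/
def ratCode (r : ℚ) : RatCode := (r.num, r.den)

/-- The value of a fraction. -/
def RatCode.value (r : RatCode) : ℚ := (r.1 : ℚ) / (r.2 : ℚ)

/-- Code of a comparison operator. -/
def Cmp.code : Cmp → ℕ
  | gt => 0
  | ge => 1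
  | eq => 2
  | le => 3
  | lt => 4

section Codes

variable {s m n : ℕ} {y : Fin n → ℕ}

/-- Position of a clock in its level: the main clock is `0`, the auxiliary clock `j` is
`j + 1`. -/
def clockIndex {b : ℕ} : Option (Fin b) → ℕ
  | none => 0
  | some j => j.val + 1

/-- A family indexed by the clocks, as a list of lists. -/
def clockFamilyCode {β : Type} (F : Clock (fun i : Fin n => Fin (y i)) → β) : List (List β) :=
  List.ofFn fun i => F ⟨i, none⟩ :: List.ofFn fun j => F ⟨i, some j⟩

/-- Code of an expression. -/
def linCode (C : LinExpr (Clock fun i : Fin n => Fin (y i))) : LinCode :=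
  (clockFamilyCode fun z => ratCode (C.1 z), ratCode C.2)

/-- The expression denoted by a code. -/
def LinCode.expr (y : Fin n → ℕ) (c : LinCode) : LinExpr (Clock fun i : Fin n => Fin (y i)) :=
  (fun z => RatCode.value ((c.1.getD z.1.val []).getD (clockIndex z.2) (0, 1)),
    RatCode.value c.2)

/-- Code of a transition. -/
def Transition.code (e : Transition (Fin s) (Fin m) (Clock fun i : Fin n => Fin (y i))) :
    TransitionCode :=
  (e.src.val, e.guard.map fun c => (linCode c.1, c.2.code), e.action.map Fin.val,
    clockFamilyCode fun z => linCode (e.update z), e.tgt.val)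

open Classical in
/-- Code of an interrupt timed automaton whose finite sets are initial segments of `ℕ`. -/
noncomputable def ITA.code (A : ITA (Fin s) (Fin m) fun i : Fin n => Fin (y i)) : ITACode :=
  (s, m, List.ofFn y, A.init.val, List.ofFn fun q => decide (q ∈ A.final),
    List.ofFn fun q => (A.level q).val, List.ofFn fun q => clockIndex (A.act q),
    A.trans.map Transition.code)

/-- The code `c` represents the class `R`: it gives its control state, and for each level `k` up
to the level of that state exactly the pairs of the preorder on `E_k`. -/
def ClassCode.Represents {A : ITA (Fin s) (Fin m) fun i : Fin n => Fin (y i)}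
    (c : ClassCode) (R : A.Class) : Prop :=
  c.1 = R.state.val ∧
  ∀ (k : Fin n) (hk : k ≤ A.level R.state) (C C' : LinExpr (Clock fun i : Fin n => Fin (y i))),
    (∃ p ∈ c.2.getD k.val [], LinCode.expr y p.1 = C ∧ LinCode.expr y p.2 = C') ↔
      ∃ (hC : C ∈ A.E k) (hC' : C' ∈ A.E k), R.le k hk ⟨C, hC⟩ ⟨C', hC'⟩

/-- The code `B` represents the class automaton of `A`: its states represent pairwise distinct
classes, among which are all the accessible ones, and its initial state, final states and edges
are those of the class automaton. -/
structure ClassAutomatonCode.Represents (B : ClassAutomatonCode)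
    (A : ITA (Fin s) (Fin m) fun i : Fin n => Fin (y i)) : Prop where
  states : ∀ c ∈ B.1, ∃ R : A.Class, c.Represents R
  injective : ∀ c ∈ B.1, ∀ c' ∈ B.1, ∀ R : A.Class, c.Represents R → c'.Represents R → c = c'
  accessible : ∀ R : A.Class, R.Accessible → ∃ c ∈ B.1, c.Represents R
  start : B.2.1 ∈ B.1 ∧ ∃ R : A.Class, B.2.1.Represents R ∧ A.initConfig ∈ R.sem
  final_subset : ∀ c ∈ B.2.2.1, c ∈ B.1
  final : ∀ c ∈ B.1, ∀ R : A.Class, c.Represents R → (c ∈ B.2.2.1 ↔ R.state ∈ A.final)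
  edges_subset : ∀ t ∈ B.2.2.2, t.1 ∈ B.1 ∧ t.2.2 ∈ B.1 ∧
    ∃ l : Option (Fin A.trans.length), t.2.1 = l.map Fin.val
  edges : ∀ c ∈ B.1, ∀ c' ∈ B.1, ∀ R R' : A.Class, c.Represents R → c'.Represents R' →
    ∀ l : Option (Fin A.trans.length),
      (c, l.map Fin.val, c') ∈ B.2.2.2 ↔ ITA.Class.edge l R R'

end Codes

/-!
The proof rests on two facts about the saturated sets `E_k`.

They are finite (`ITA.finite_E`). An update keeps a main clock or replaces it by an expression over
strictly lower main clocks, so that the closure of a finite set of expressions under updates is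
finite, by induction on the highest level that occurs (`LinExpr.exists_finite_subst_closed`). As
`E_k` receives bounds only from higher levels, finiteness follows from the highest level down.

They contain every comparison that matters. Up to a nonzero factor, an expression `C` is `z` minus
its bound for `z`, or `0` minus this bound if `z` does not occur in it. Hence the order of the
values on `E_k` determines the sign of every expression whose bound is in `E_k` (`ITA.sign_iff`): of
guards, and of the differences `C[u] - C'[u]` which decide the order after a discrete step. So two
configurations in the same class have the same discrete steps, up to their classes
(`ITA.discreteEdge_classOf_iff`). In a time step, only the value of the active clock changes among
those of the finite set `E_k` at the level of the state. It meets the greater values one after the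
other, and each change of the order is a time successor (`isSameDelay_or_exists_isPostDelay`);
conversely, each time successor is reached by a delay (`exists_isPostDelay`). This gives the
bisimulation, and with it the equality of the languages and regularity.

For the algorithm, the class automaton is built from rational configurations, one in each
accessible class. These exist, as the delay that leads to the time successor can be chosen rational
for rational clock values (`ITA.exists_rational_of_accessible`). By the bisimulation, the edges
that leave the class of a configuration are computed from this configuration alone, so that no
systems of linear inequalities have to be solved. The algorithm searches for a number of rounds of
saturation after which no new expressions appear, and for a list of rational configurations whose
classes are closed under time successors and discrete steps. Every result of the search is correct
(`ITA.candidate_represents`), and the search succeeds (`ITA.exists_candidate`). All tests are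
primitive recursive, which is shown by composition rules (`ITACode.primrec_candidate`).
-/

/-! ### Linear expressions and bounds -/

namespace LinExpr

section Eval

variable {X : Type*} [Fintype X] (v : X → ℝ)

@[simp] theorem eval_zero : eval v (0 : LinExpr X) = 0 := by simp [eval]

theorem eval_add (C D : LinExpr X) : eval v (C + D) = eval v C + eval v D := by
  simp only [eval, Prod.fst_add, Prod.snd_add, Pi.add_apply, Rat.cast_add, add_mul,
    Finset.sum_add_distrib]
  ring

theorem eval_smul (a : ℚ) (C : LinExpr X) : eval v (a • C) = a * eval v C := by
  simp only [eval, Prod.smul_fst, Prod.smul_snd, Pi.smul_apply, smul_eq_mul, Rat.cast_mul,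
    mul_add, Finset.mul_sum, mul_assoc]

theorem eval_neg (C : LinExpr X) : eval v (-C) = -eval v C := by
  have := eval_smul v (-1) C
  simpa using this

theorem eval_sub (C D : LinExpr X) : eval v (C - D) = eval v C - eval v D := by
  rw [sub_eq_add_neg, eval_add, eval_neg, sub_eq_add_neg]

@[simp] theorem var_coeff_self {X : Type*} (x : X) : (var x).1 x = 1 := by
  simp [var]

theorem var_coeff_of_ne {X : Type*} {x z : X} (h : z ≠ x) : (var x).1 z = 0 := by
  classical
  simp [var, Pi.single_eq_of_ne h]

@[simp] theorem eval_var (x : X) : eval v (var x) = v x := by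
  unfold eval
  rw [Finset.sum_eq_single x (fun z _ hz => by rw [var_coeff_of_ne hz]; simp) (by simp),
    var_coeff_self]
  simp [var]

theorem eval_sum {ι : Type*} (s : Finset ι) (F : ι → LinExpr X) :
    eval v (∑ i ∈ s, F i) = ∑ i ∈ s, eval v (F i) := by
  classical
  induction s using Finset.induction_on with
  | empty => simp
  | insert i s hi ih => rw [Finset.sum_insert hi, Finset.sum_insert hi, eval_add, ih]

theorem eval_subst (u : X → LinExpr X) (C : LinExpr X) :
    eval v (C.subst u) = eval (fun x => eval v (u x)) C := by
  rw [subst, eval_add, eval_sum]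
  simp only [eval_smul]
  simp [eval]

theorem eval_congr {v w : X → ℝ} {C : LinExpr X} (h : ∀ x, C.1 x ≠ 0 → v x = w x) :
    eval v C = eval w C := by
  unfold eval
  congr 1
  refine Finset.sum_congr rfl fun x _ => ?_
  by_cases hx : C.1 x = 0
  · simp [hx]
  · rw [h x hx]

theorem eval_mem (K : Subfield ℝ) (hv : ∀ x, v x ∈ K) (C : LinExpr X) : eval v C ∈ K :=
  K.add_mem (K.sum_mem fun x _ => K.mul_mem (SubfieldClass.ratCast_mem K _) (hv x))
    (SubfieldClass.ratCast_mem K _)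

end Eval

section Bound

variable {X : Type*}

theorem bound_of_coeff_eq_zero {C : LinExpr X} {z : X} (h : C.1 z = 0) : C.bound z = -C := by
  classical
  unfold bound
  rw [normalize, if_pos h]
  congr 1
  ext x
  · by_cases hx : x = z
    · subst hx; simp [h]
    · simp [Function.update_of_ne hx]
  · rfl

@[simp] theorem bound_zero (z : X) : (0 : LinExpr X).bound z = 0 := by
  rw [bound_of_coeff_eq_zero (by simp), neg_zero]

theorem bound_coeff_self (C : LinExpr X) (z : X) : (C.bound z).1 z = 0 := by
  simp [bound]

theorem bound_coeff_of_ne (C : LinExpr X) {z x : X} (h : x ≠ z) :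
    (C.bound z).1 x = if C.1 z = 0 then -C.1 x else -((C.1 z)⁻¹ * C.1 x) := by
  classical
  by_cases hz : C.1 z = 0 <;> simp [bound, normalize, hz, Function.update_of_ne h]

theorem bound_const (C : LinExpr X) (z : X) :
    (C.bound z).2 = if C.1 z = 0 then -C.2 else -((C.1 z)⁻¹ * C.2) := by
  by_cases hz : C.1 z = 0 <;> simp [bound, normalize, hz]

theorem eq_smul_sub_bound {C : LinExpr X} {z : X} (h : C.1 z ≠ 0) :
    C = C.1 z • (var z - C.bound z) := by
  classical
  ext x
  · by_cases hx : x = z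
    · subst hx; simp [bound_coeff_self, var]
    · simp [bound_coeff_of_ne C hx, h, var, hx]
  · simp [bound_const, h, var]

theorem coeff_ne_zero_of_bound {C : LinExpr X} {z x : X} (h : (C.bound z).1 x ≠ 0) :
    x ≠ z ∧ C.1 x ≠ 0 := by
  have hx : x ≠ z := by rintro rfl; exact h (bound_coeff_self C x)
  refine ⟨hx, fun h0 => h ?_⟩
  rw [bound_coeff_of_ne C hx, h0]; simp

end Bound

section Levels

variable {n : ℕ} {Y : Fin n → Type*}

theorem eval_truncate [∀ i, Fintype (Y i)] {v : Clock Y → ℝ} {l : Fin n}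
    (hv : ∀ z : Clock Y, l < z.1 → v z = 0) (C : LinExpr (Clock Y)) :
    eval v (C.truncate l) = eval v C := by
  unfold eval truncate
  congr 1
  refine Finset.sum_congr rfl fun z _ => ?_
  by_cases h : z.1 ≤ l
  · simp [h]
  · simp [hv z (not_le.1 h)]

theorem overMainBelow_zero (i : Fin n) : (0 : LinExpr (Clock Y)).OverMainBelow i :=
  fun _ h => absurd rfl h

theorem var_coeff_ne_zero {X : Type*} {x z : X} (h : (var x).1 z ≠ 0) : z = x := by
  by_contra hz
  exact h (var_coeff_of_ne hz)

end Levels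

end LinExpr

/-! ### Finiteness of the saturated sets -/

namespace LinExpr

variable {n : ℕ} {Y : Fin n → Type*}

theorem OverMainBelow.mono {i j : Fin n} (hij : i ≤ j) {C : LinExpr (Clock Y)}
    (h : C.OverMainBelow i) : C.OverMainBelow j :=
  fun z hz => ⟨(h z hz).1.trans_le hij, (h z hz).2⟩

/-- `C` only contains main clocks whose level, as a natural number, is less than `j`. -/
def OverMainBelowNat (j : ℕ) (C : LinExpr (Clock Y)) : Prop :=
  ∀ z, C.1 z ≠ 0 → z.1.val < j ∧ z.2 = none

theorem OverMainBelowNat.add {j : ℕ} {C D : LinExpr (Clock Y)} (hC : C.OverMainBelowNat j)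
    (hD : D.OverMainBelowNat j) : (C + D).OverMainBelowNat j := by
  intro z hz
  by_cases h : C.1 z = 0
  · refine hD z fun h' => hz ?_
    simp [h, h']
  · exact hC z h

theorem OverMainBelowNat.smul {j : ℕ} {C : LinExpr (Clock Y)} (a : ℚ)
    (hC : C.OverMainBelowNat j) : (a • C).OverMainBelowNat j := by
  intro z hz
  refine hC z fun h => hz ?_
  simp [h]

theorem OverMainBelowNat.mono {i j : ℕ} (hij : i ≤ j) {C : LinExpr (Clock Y)}
    (h : C.OverMainBelowNat i) : C.OverMainBelowNat j :=
  fun z hz => ⟨(h z hz).1.trans_le hij, (h z hz).2⟩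

section Subst

variable {X : Type*} [Fintype X]

theorem subst_add (u : X → LinExpr X) (C D : LinExpr X) :
    (C + D).subst u = C.subst u + D.subst u := by
  have : ((0 : X → ℚ), C.2 + D.2) = (0, C.2) + (0, D.2) := by simp
  simp only [subst, Prod.fst_add, Prod.snd_add, Pi.add_apply, add_smul, Finset.sum_add_distrib,
    this]
  abel

theorem subst_smul (u : X → LinExpr X) (a : ℚ) (C : LinExpr X) :
    (a • C).subst u = a • C.subst u := by
  simp only [subst, Prod.smul_fst, Prod.smul_snd, Pi.smul_apply, smul_eq_mul, mul_smul, smul_add,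
    Finset.smul_sum, Prod.smul_mk, smul_zero]

@[simp] theorem subst_var (u : X → LinExpr X) (x : X) : (var x).subst u = u x := by
  unfold subst
  rw [Finset.sum_eq_single x (fun z _ hz => by rw [var_coeff_of_ne hz, zero_smul]) (by simp),
    var_coeff_self]
  ext <;> simp [var]

theorem subst_coeff (u : X → LinExpr X) (C : LinExpr X) (z : X) :
    (C.subst u).1 z = ∑ x, C.1 x * (u x).1 z := by
  simp [subst, Prod.fst_sum, Finset.sum_apply]

theorem subst_const (u : X → LinExpr X) (C : LinExpr X) :
    (C.subst u).2 = ∑ x, C.1 x * (u x).2 + C.2 := by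
  simp [subst, Prod.snd_sum]

theorem exists_of_subst_coeff_ne_zero {u : X → LinExpr X} {C : LinExpr X} {z : X}
    (h : (C.subst u).1 z ≠ 0) : ∃ x, C.1 x ≠ 0 ∧ (u x).1 z ≠ 0 := by
  rw [subst_coeff] at h
  obtain ⟨x, -, hx⟩ := Finset.exists_ne_zero_of_sum_ne_zero h
  exact ⟨x, left_ne_zero_of_mul hx, right_ne_zero_of_mul hx⟩

end Subst

/-- Under substitutions that map each main clock of level `< K` to itself or to an expression over
strictly lower main clocks, a finite set of expressions over these clocks has a finite closure.
A substitution either keeps the clock of the highest level or replaces the expression by one over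
lower clocks, so that the induction is on the highest level that occurs. -/
theorem exists_finite_subst_closed [∀ i, Fintype (Y i)]
    {U : Set (Clock Y → LinExpr (Clock Y))} (hU : U.Finite) {K : ℕ} (hK : K ≤ n)
    (hu : ∀ u ∈ U, ∀ i : Fin n, i.val < K →
      u ⟨i, none⟩ = var ⟨i, none⟩ ∨ (u ⟨i, none⟩).OverMainBelow i)
    {j : ℕ} (hj : j ≤ K) {S : Set (LinExpr (Clock Y))} (hS : S.Finite)
    (hSj : ∀ C ∈ S, C.OverMainBelowNat j) :
    ∃ T : Set (LinExpr (Clock Y)), S ⊆ T ∧ T.Finite ∧ (∀ C ∈ T, C.OverMainBelowNat j) ∧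
      ∀ C ∈ T, ∀ u ∈ U, C.subst u ∈ T := by
  classical
  induction j generalizing S with
  | zero =>
    refine ⟨S, subset_rfl, hS, hSj, fun C hC u _ => ?_⟩
    have h0 : ∀ z, C.1 z = 0 := fun z => by
      by_contra h
      exact absurd (hSj C hC z h).1 (by simp)
    convert hC using 1
    ext z
    · simp [subst_coeff, h0]
    · simp [subst_const, h0]
  | succ j ih =>
    have ih := @ih (by omega)
    set i : Fin n := ⟨j, by omega⟩
    set x : Clock Y := ⟨i, none⟩
    have hx : ∀ u ∈ U, u x = var x ∨ (u x).OverMainBelow i := fun u h => hu u h i hj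
    let rest : LinExpr (Clock Y) → LinExpr (Clock Y) := fun C => (Function.update C.1 x 0, C.2)
    have hsplit : ∀ C : LinExpr (Clock Y), C = C.1 x • var x + rest C := by
      intro C
      ext z
      · by_cases hz : z = x
        · subst hz; simp [rest]
        · simp [rest, hz, var_coeff_of_ne hz]
      · simp [rest, var]
    have hrest : ∀ C ∈ S, (rest C).OverMainBelowNat j := by
      intro C hC z hz
      have hzx : z ≠ x := by rintro rfl; simp [rest] at hz
      have hCz : C.1 z ≠ 0 := by simpa [rest, hzx] using hz
      obtain ⟨h1, h2⟩ := hSj C hC z hCz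
      refine ⟨lt_of_le_of_ne (Nat.lt_succ_iff.1 h1) fun h => hzx ?_, h2⟩
      obtain ⟨a, b⟩ := z
      obtain rfl : b = none := h2
      obtain rfl : a = i := Fin.ext h
      rfl
    obtain ⟨T', hST', hT', hT'j, hT'c⟩ := ih (hS.image rest) (by
      rintro _ ⟨C, hC, rfl⟩
      exact hrest C hC)
    let A : Set ℚ := (fun C : LinExpr (Clock Y) => C.1 x) '' S
    let V : Set (LinExpr (Clock Y)) := {e ∈ (fun u => u x) '' U | e.OverMainBelow i}
    have hV : V.Finite := (hU.image _).subset fun e he => he.1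
    let G : Set (LinExpr (Clock Y)) :=
      (fun p : (ℚ × LinExpr (Clock Y)) × LinExpr (Clock Y) => p.1.1 • p.1.2 + p.2) ''
        ((A ×ˢ V) ×ˢ T')
    have hG : G.Finite := (((hS.image _).prod hV).prod hT').image _
    obtain ⟨T₂, hGT₂, hT₂, hT₂j, hT₂c⟩ := ih hG (by
      rintro _ ⟨⟨⟨a, e⟩, D⟩, ⟨⟨-, he⟩, hD⟩, rfl⟩
      exact OverMainBelowNat.add (OverMainBelowNat.smul a fun z hz => he.2 z hz) (hT'j D hD))
    let T₁ : Set (LinExpr (Clock Y)) :=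
      (fun p : ℚ × LinExpr (Clock Y) => p.1 • var x + p.2) '' (A ×ˢ T')
    refine ⟨T₁ ∪ T₂, ?_, (((hS.image _).prod hT').image _).union hT₂, ?_, ?_⟩
    · intro C hC
      exact Or.inl ⟨(C.1 x, rest C), ⟨⟨C, hC, rfl⟩, hST' ⟨C, hC, rfl⟩⟩, (hsplit C).symm⟩
    · rintro _ (⟨⟨a, D⟩, ⟨-, hD⟩, rfl⟩ | hC)
      · refine OverMainBelowNat.add (OverMainBelowNat.smul a fun z hz => ?_)
          ((hT'j D hD).mono j.le_succ)
        obtain rfl := var_coeff_ne_zero hz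
        exact ⟨Nat.lt_succ_self j, rfl⟩
      · exact (hT₂j _ hC).mono j.le_succ
    · rintro _ (⟨⟨a, D⟩, ⟨ha, hD⟩, rfl⟩ | hC) u hu'
      · simp only [subst_add, subst_smul, subst_var]
        rcases hx u hu' with h | h
        · rw [h]
          exact Or.inl ⟨(a, D.subst u), ⟨ha, hT'c D hD u hu'⟩, rfl⟩
        · exact Or.inr (hGT₂ ⟨((a, u x), D.subst u),
            ⟨⟨ha, ⟨u, hu', rfl⟩, h⟩, hT'c D hD u hu'⟩, rfl⟩)
      · exact Or.inr (hT₂c _ hC u hu')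

end LinExpr

namespace ITA

open LinExpr

variable {Act Q : Type*} {n : ℕ} {Y : Fin n → Type*} (A : ITA Act Q Y)

/-- Main clocks of levels below both levels of a transition keep their value or get an expression
over lower main clocks. -/
theorem update_main {e : Transition Act Q (Clock Y)} (he : e ∈ A.trans) {i : Fin n}
    (hi : i ≤ A.level e.src) (hi' : i ≤ A.level e.tgt)
    (hne : i < A.level e.src ∨ A.level e.src ≠ A.level e.tgt) :
    e.update ⟨i, none⟩ = var ⟨i, none⟩ ∨ (e.update ⟨i, none⟩).OverMainBelow i := by
  have := A.update_ok e he ⟨i, none⟩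
  rw [UpdateAllowed, if_pos ⟨hi, hi'⟩] at this
  rcases this with h | h | ⟨h | ⟨h, h'⟩, -⟩
  · exact Or.inl h
  · exact Or.inr h
  · exact absurd rfl h
  · rcases hne with h1 | h1
    · exact absurd h h1.ne
    · exact absurd h' h1

theorem update_clock {e : Transition Act Q (Clock Y)} (he : e ∈ A.trans) {k : Fin n}
    (hk : k ≤ A.level e.src) (hk' : k ≤ A.level e.tgt) (y : Option (Y k)) :
    (∃ y', e.update ⟨k, y⟩ = var ⟨k, y'⟩) ∨ (e.update ⟨k, y⟩).OverMainBelow k := by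
  have := A.update_ok e he ⟨k, y⟩
  rw [UpdateAllowed, if_pos ⟨hk, hk'⟩] at this
  rcases this with h | h | ⟨-, h⟩
  · exact Or.inl ⟨y, h⟩
  · exact Or.inr h
  · exact Or.inl h

theorem update_above {e : Transition Act Q (Clock Y)} (he : e ∈ A.trans) {z : Clock Y}
    (hz : A.level e.src < z.1) : e.update z = var z := by
  have := A.update_ok e he z
  rwa [UpdateAllowed, if_neg (fun h => absurd h.1 (not_le.2 hz)), if_neg (not_le.2 hz)] at this

theorem update_reset {e : Transition Act Q (Clock Y)} (he : e ∈ A.trans) {z : Clock Y}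
    (hz : z.1 ≤ A.level e.src) (hz' : A.level e.tgt < z.1) : e.update z = 0 := by
  have := A.update_ok e he z
  rwa [UpdateAllowed, if_neg (fun h => absurd h.2 (not_le.2 hz')), if_pos hz] at this

variable {A} [∀ i, Fintype (Y i)]

/-- The elements of `E_k` are the clocks of level `k` and expressions over lower main clocks. -/
theorem Saturated.shape {k : Fin n} {C : LinExpr (Clock Y)} (h : A.Saturated k C) :
    (∃ y, C = var ⟨k, y⟩) ∨ C.OverMainBelow k := by
  induction h with
  | clock k y => exact Or.inl ⟨y, rfl⟩
  | zero k => exact Or.inr (overMainBelow_zero k)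
  | @guard e c y he hc hC =>
    refine Or.inr fun z hz => ?_
    obtain ⟨h1, h2⟩ := coeff_ne_zero_of_bound hz
    exact (hC z h2).resolve_left h1
  | @update k e C he hk hk' _ ih =>
    rcases ih with ⟨y, rfl⟩ | hC
    · rw [subst_var]
      exact A.update_clock he hk hk' y
    · refine Or.inr fun z hz => ?_
      obtain ⟨⟨i, y⟩, hx, hz⟩ := exists_of_subst_coeff_ne_zero hz
      obtain ⟨hi, rfl⟩ : i < k ∧ y = none := hC _ hx
      rcases A.update_main he (hi.le.trans hk) (hi.le.trans hk') (Or.inl (hi.trans_le hk))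
        with h | h
      · rw [h] at hz
        rw [var_coeff_ne_zero hz]
        exact ⟨hi, rfl⟩
      · exact h.mono hi.le z hz
  | @cross k e C C' he hk hk' _ _ _ ih ih' =>
    have key : ∀ {C : LinExpr (Clock Y)}, ((∃ y, C = var ⟨k, y⟩) ∨ C.OverMainBelow k) →
        ∀ z : Clock Y, z.1 ≤ A.level e.src → (C.subst e.update).1 z ≠ 0 → z.2 = none := by
      rintro C hC z hzl hz
      obtain ⟨x, hx, hz⟩ := exists_of_subst_coeff_ne_zero hz
      have hlow : x.1 ≤ A.level e.src := by
        by_contra hlt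
        rw [A.update_above he (not_le.1 hlt)] at hz
        exact hlt (var_coeff_ne_zero hz ▸ hzl)
      obtain ⟨i, y⟩ := x
      obtain rfl : y = none := by
        rcases hC with ⟨y', rfl⟩ | hC
        · cases var_coeff_ne_zero hx
          exact absurd hlow (not_le.2 hk)
        · exact (hC _ hx).2
      rcases A.update_main he hlow (hlow.trans (hk.le.trans hk'))
        (Or.inr (hk.trans_le hk').ne) with h | h
      · rw [h] at hz
        rw [var_coeff_ne_zero hz]
      · exact (h z hz).2
    refine Or.inr fun z hz => ?_
    obtain ⟨h1, h2⟩ := coeff_ne_zero_of_bound hz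
    have hzl : z.1 ≤ A.level e.src := by
      by_contra h
      exact h2 (if_neg h)
    have hz2 : z.2 = none := by
      have h3 : (C.subst e.update).1 z - (C'.subst e.update).1 z ≠ 0 := by
        simpa [truncate, hzl] using h2
      by_cases h4 : (C.subst e.update).1 z = 0
      · exact key ih' z hzl fun h5 => h3 (by rw [h4, h5, sub_zero])
      · exact key ih z hzl h4
    refine ⟨lt_of_le_of_ne hzl fun h => h1 ?_, hz2⟩
    obtain ⟨i, y⟩ := z
    obtain rfl : i = _ := h
    obtain rfl : y = none := hz2
    rfl

/-- An element of `E_k` other than a given clock of level `k` does not contain this clock. -/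
theorem Saturated.coeff_eq_zero {k : Fin n} {C : LinExpr (Clock Y)} (h : A.Saturated k C)
    {y : Option (Y k)} (hne : C ≠ var ⟨k, y⟩) : C.1 ⟨k, y⟩ = 0 := by
  by_contra h0
  rcases h.shape with ⟨y', rfl⟩ | h
  · rw [var_coeff_ne_zero h0] at hne
    exact hne rfl
  · exact lt_irrefl _ (h _ h0).1

theorem Saturated.coeff_eq_zero_of_lt {k : Fin n} {C : LinExpr (Clock Y)} (h : A.Saturated k C)
    {z : Clock Y} (hz : k < z.1) : C.1 z = 0 := by
  by_contra h0
  rcases h.shape with ⟨y', rfl⟩ | h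
  · rw [var_coeff_ne_zero h0] at hz
    exact lt_irrefl _ hz
  · exact lt_asymm hz (h _ h0).1

/-- Finiteness goes from the highest level down: the rule that adds expressions to `E_k` from a
higher `E_j` only contributes finitely many of them. -/
theorem finite_E (k : Fin n) : (A.E k).Finite := by
  induction hm : n - k.val using Nat.strong_induction_on generalizing k with
  | _ m ih =>
  subst hm
  have hfin : ∀ j : Fin n, k < j → (A.E j).Finite := fun j hj =>
    ih (n - j.val) (by have : k.val < j.val := hj; omega) j rfl
  have htr : {e | e ∈ A.trans}.Finite := A.trans.finite_toSet
  let U : Set (Clock Y → LinExpr (Clock Y)) :=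
    Transition.update '' {e ∈ {e | e ∈ A.trans} | k ≤ A.level e.src ∧ k ≤ A.level e.tgt}
  have hU : U.Finite := (htr.subset fun e he => he.1).image _
  let S₁ : Set (LinExpr (Clock Y)) := ⋃ e ∈ {e | e ∈ A.trans}, ⋃ c ∈ {c | c ∈ e.guard},
    Set.range fun z => LinExpr.bound c.1 z
  let S₂ : Set (LinExpr (Clock Y)) := ⋃ e ∈ {e | e ∈ A.trans}, ⋃ j ∈ {j | k < j},
    Set.image2 (fun C C' => ((C.subst e.update - C'.subst e.update).truncate k).bound
      ⟨k, none⟩) (A.E j) (A.E j)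
  let S₃ : Set (LinExpr (Clock Y)) := ⋃ e ∈ {e | e ∈ A.trans},
    Set.range fun y => e.update ⟨k, y⟩
  have hS : ({0} ∪ S₁ ∪ S₂ ∪ S₃).Finite := by
    refine (((Set.finite_singleton _).union ?_).union ?_).union ?_
    · exact htr.biUnion fun e _ => (e.guard.finite_toSet).biUnion fun c _ => Set.finite_range _
    · exact htr.biUnion fun e _ => (Set.toFinite _).biUnion fun j hj =>
        (hfin j hj).image2 _ (hfin j hj)
    · exact htr.biUnion fun e _ => Set.finite_range _
  obtain ⟨T, hST, hT, -, hTc⟩ := exists_finite_subst_closed (K := k.val) hU k.2.le (by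
    rintro _ ⟨e, ⟨he, h1, h2⟩, rfl⟩ i hi
    have hik : i < k := hi
    exact A.update_main he (hik.le.trans h1) (hik.le.trans h2) (Or.inl (hik.trans_le h1)))
    le_rfl (S := {C ∈ {0} ∪ S₁ ∪ S₂ ∪ S₃ | C.OverMainBelow k}) (hS.subset fun C hC => hC.1)
    (fun C hC => fun z hz => hC.2 z hz)
  have hsub : ∀ j C, A.Saturated j C → j = k →
      C ∈ Set.range (fun y => var (⟨k, y⟩ : Clock Y)) ∪ T := by
    intro j C h
    have hshape := h.shape
    induction h with
    | clock j y => rintro rfl; exact Or.inl ⟨y, rfl⟩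
    | zero j =>
      rintro rfl
      exact Or.inr (hST ⟨Or.inl (Or.inl (Or.inl rfl)), overMainBelow_zero _⟩)
    | @guard e c y he hc hC =>
      intro hk
      subst hk
      rcases hshape with ⟨y', h⟩ | h
      · exact Or.inl ⟨y', h.symm⟩
      · refine Or.inr (hST ⟨Or.inl (Or.inl (Or.inr ?_)), h⟩)
        exact Set.mem_biUnion (show e ∈ {e | e ∈ A.trans} from he)
          (Set.mem_biUnion (show c ∈ {c | c ∈ e.guard} from hc) ⟨_, rfl⟩)
    | @update j e C he hj hj' h0 ih =>
      rintro rfl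
      rcases hshape with ⟨y', h⟩ | h
      · exact Or.inl ⟨y', h.symm⟩
      rcases ih h0.shape rfl with ⟨y', rfl⟩ | hCT
      · rw [subst_var] at h ⊢
        refine Or.inr (hST ⟨Or.inr ?_, h⟩)
        exact Set.mem_biUnion (show e ∈ {e | e ∈ A.trans} from he) ⟨y', rfl⟩
      · exact Or.inr (hTc _ hCT _ ⟨e, ⟨he, hj, hj'⟩, rfl⟩)
    | @cross j e C C' he hj hj' hC hC' _ _ _ =>
      intro hk
      subst hk
      rcases hshape with ⟨y', h⟩ | h
      · exact Or.inl ⟨y', h.symm⟩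
      · refine Or.inr (hST ⟨Or.inl (Or.inr ?_), h⟩)
        exact Set.mem_biUnion (show e ∈ {e | e ∈ A.trans} from he)
          (Set.mem_biUnion hj ⟨C, hC, C', hC', rfl⟩)
  exact ((Set.finite_range _).union hT).subset fun C hC => hsub k C hC rfl

instance (k : Fin n) : Finite (A.E k) := (finite_E k).to_subtype

end ITA

/-! ### Moving one value in a finite order -/

section Delay

variable {α : Type*} (val : α → ℝ) (a : α)

open Classical in
/-- The values after a delay `d`: only the value of `a` increases. -/
noncomputable def delayed (d : ℝ) : α → ℝ := Function.update val a (val a + d)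

theorem delayed_self (d : ℝ) : delayed val a d a = val a + d := by simp [delayed]

theorem delayed_of_ne (d : ℝ) {f : α} (h : f ≠ a) : delayed val a d f = val f := by
  simp [delayed, h]

theorem delayed_zero : delayed val a 0 = val := by simp [delayed]

/-- The order of the values after the delay `d` is the successor of the present one. -/
def IsPostDelay (d : ℝ) : Prop :=
  ∀ f g, delayed val a d f ≤ delayed val a d g ↔ postLE (fun f g => val f ≤ val g) a f g

/-- The order of the values is not changed by the delay `d`. -/
def IsSameDelay (d : ℝ) : Prop :=
  ∀ f g, delayed val a d f ≤ delayed val a d g ↔ val f ≤ val g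

/-- Another element has the same value as `a`. -/
def Tied : Prop := ∃ h, h ≠ a ∧ val h ≤ val a ∧ val a ≤ val h

variable {val a}

theorem isSameDelay_zero : IsSameDelay val a 0 := by
  intro f g; rw [delayed_zero]

/-- A tied value gets just above the others by a short positive delay. -/
theorem isPostDelay_of_tied (ht : Tied val a) {d : ℝ} (hd : 0 < d)
    (hgap : ∀ h, val a < val h → d < val h - val a) : IsPostDelay val a d := by
  intro f g
  simp only [postLE, not_true_eq_false, false_and, or_false, true_and,
    show (∃ h, h ≠ a ∧ val h ≤ val a ∧ val a ≤ val h) from ht]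
  by_cases hf : f = a <;> by_cases hg : g = a
  · subst hf; subst hg; simp
  · subst hf
    rw [delayed_self, delayed_of_ne _ _ _ hg]
    constructor
    · intro h
      exact ⟨by linarith, fun h' => by linarith [h'.2.2]⟩
    · rintro ⟨h, h'⟩
      have : val f < val g := lt_of_not_ge fun h1 => h' ⟨rfl, hg, h1⟩
      linarith [hgap g this]
  · subst hg
    rw [delayed_self, delayed_of_ne _ _ _ hf]
    simp only [hf, false_and, not_false_eq_true, and_true]
    constructor
    · intro h
      by_contra h'
      linarith [hgap f (lt_of_not_ge h')]
    · intro h; linarith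
  · rw [delayed_of_ne _ _ _ hg, delayed_of_ne _ _ _ hf]
    simp [hf]

/-- A value that is not tied merges with the next greater one. -/
theorem isPostDelay_of_not_tied (ht : ¬ Tied val a) {g₀ : α} (hg₀ : val a < val g₀)
    (hmin : ∀ h, val a < val h → val g₀ ≤ val h) : IsPostDelay val a (val g₀ - val a) := by
  have ht' : ¬ ∃ h, h ≠ a ∧ val h ≤ val a ∧ val a ≤ val h := ht
  have hlt : ∀ h, h ≠ a → val h ≤ val a → val h < val a := fun h hne hle =>
    lt_of_not_ge fun h' => ht ⟨h, hne, hle, h'⟩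
  intro f g
  simp only [postLE, ht', not_false_eq_true, true_and, false_and, false_or]
  by_cases hf : f = a <;> by_cases hg : g = a
  · subst hf; subst hg; simp
  · subst hf
    rw [delayed_self, delayed_of_ne _ _ _ hg]
    simp only [hg, false_and, or_false, add_sub_cancel]
    refine ⟨fun h => by linarith, fun h => hmin g ?_⟩
    by_contra h'
    exact ht ⟨g, hg, not_lt.1 h', h⟩
  · subst hg
    rw [delayed_self, delayed_of_ne _ _ _ hf, add_sub_cancel]
    simp only [true_and, not_le]
    constructor
    · intro h
      by_cases hfg : val f ≤ val g
      · exact Or.inl hfg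
      · exact Or.inr ⟨not_le.1 hfg, fun h' hh' => h.trans (hmin h' hh')⟩
    · rintro (h | ⟨-, h⟩)
      · linarith
      · exact h g₀ hg₀
  · rw [delayed_of_ne _ _ _ hg, delayed_of_ne _ _ _ hf]
    simp [hg]

theorem isSameDelay_of_not_tied (ht : ¬ Tied val a) {d : ℝ} (hd : 0 ≤ d)
    (hgap : ∀ h, val a < val h → d < val h - val a) : IsSameDelay val a d := by
  intro f g
  by_cases hf : f = a <;> by_cases hg : g = a
  · subst hf; subst hg; simp
  · subst hf
    rw [delayed_self, delayed_of_ne _ _ _ hg]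
    refine ⟨fun h => by linarith, fun h => ?_⟩
    have : val f < val g := lt_of_not_ge fun h1 => ht ⟨g, hg, h1, h⟩
    linarith [hgap g this]
  · subst hg
    rw [delayed_self, delayed_of_ne _ _ _ hf]
    constructor
    · intro h
      by_contra h'
      linarith [hgap f (lt_of_not_ge h')]
    · intro h; linarith
  · rw [delayed_of_ne _ _ _ hg, delayed_of_ne _ _ _ hf]

theorem IsSameDelay.isPostDelay (ht : ¬ Tied val a) (hmax : ∀ h, val h ≤ val a) {d : ℝ}
    (hs : IsSameDelay val a d) : IsPostDelay val a d := by
  intro f g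
  have ht' : ¬ ∃ h, h ≠ a ∧ val h ≤ val a ∧ val a ≤ val h := ht
  rw [hs]
  simp only [postLE, ht', not_false_eq_true, true_and, false_and, false_or, hmax f, not_true,
    and_false, or_false]

theorem exists_next [Finite α] (h : ∃ g, val a < val g) :
    ∃ g₀, val a < val g₀ ∧ ∀ h, val a < val h → val g₀ ≤ val h := by
  obtain ⟨g₀, h₀, hmin⟩ := Set.exists_min_image {g | val a < val g} val (Set.toFinite _) h
  exact ⟨g₀, h₀, hmin⟩

/-- The successor order is reached by a delay, which can be chosen in every field that contains
the values: the delay until the next value, half of it, or an arbitrary one. -/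
theorem exists_isPostDelay [Finite α] (K : Subfield ℝ) (hK : ∀ f, val f ∈ K) :
    ∃ d, 0 ≤ d ∧ d ∈ K ∧ IsPostDelay val a d := by
  by_cases hup : ∃ g, val a < val g
  · obtain ⟨g₀, h₀, hmin⟩ := exists_next hup
    by_cases ht : Tied val a
    · refine ⟨(val g₀ - val a) / 2, by linarith,
        K.div_mem (K.sub_mem (hK _) (hK _)) (ofNat_mem K 2),
        isPostDelay_of_tied ht (by linarith) ?_⟩
      intro h hh
      linarith [hmin h hh]
    · exact ⟨val g₀ - val a, by linarith, K.sub_mem (hK _) (hK _),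
        isPostDelay_of_not_tied ht h₀ hmin⟩
  · have hmax : ∀ h, val h ≤ val a := fun h => not_lt.1 fun h' => hup ⟨h, h'⟩
    by_cases ht : Tied val a
    · exact ⟨1, zero_le_one, K.one_mem, isPostDelay_of_tied ht one_pos fun h hh =>
        absurd (hmax h) (not_le.2 hh)⟩
    · exact ⟨0, le_rfl, K.zero_mem, isSameDelay_zero.isPostDelay ht hmax⟩

open Classical in
/-- A bound for the number of successor steps that can still change the order: `a` first merges
with each greater value and then separates from it. -/
noncomputable def delayRank (val : α → ℝ) (a : α) : ℕ :=
  2 * {h | val a < val h}.ncard + if Tied val a then 1 else 0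

theorem upper_delayed_subset {d : ℝ} (hd : 0 ≤ d) :
    {h | delayed val a d a < delayed val a d h} ⊆ {h | val a < val h} := by
  intro h hh
  simp only [Set.mem_ofPred_eq] at hh ⊢
  by_cases hha : h = a
  · subst hha; exact absurd hh (lt_irrefl _)
  · rw [delayed_self, delayed_of_ne _ _ _ hha] at hh
    linarith

/-- Either a delay does not change the order, or it passes through the successor order. -/
theorem isSameDelay_or_exists_isPostDelay [Finite α] {d : ℝ} (hd : 0 ≤ d) :
    IsSameDelay val a d ∨
      ∃ d₁, 0 ≤ d₁ ∧ d₁ ≤ d ∧ IsPostDelay val a d₁ ∧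
        delayRank (delayed val a d₁) a < delayRank val a := by
  rcases hd.eq_or_lt with rfl | hd
  · exact Or.inl isSameDelay_zero
  by_cases ht : Tied val a
  · right
    have untied : ∀ d₁, 0 < d₁ → (∀ h, val a < val h → d₁ < val h - val a) →
        delayRank (delayed val a d₁) a < delayRank val a := by
      intro d₁ h₁ hgap
      have hnt : ¬ Tied (delayed val a d₁) a := by
        rintro ⟨h, hne, h2, h3⟩
        rw [delayed_self, delayed_of_ne _ _ _ hne] at h2 h3
        linarith [hgap h (by linarith)]
      have := Set.ncard_le_ncard (upper_delayed_subset (val := val) (a := a) h₁.le)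
        (Set.toFinite _)
      simp only [delayRank, if_neg hnt, if_pos ht]
      omega
    by_cases hup : ∃ g, val a < val g
    · obtain ⟨g₀, h₀, hmin⟩ := exists_next hup
      have hpos : 0 < min d ((val g₀ - val a) / 2) := lt_min hd (by linarith)
      have hgap : ∀ h, val a < val h → min d ((val g₀ - val a) / 2) < val h - val a :=
        fun h hh => (min_le_right _ _).trans_lt (by linarith [hmin h hh])
      exact ⟨_, hpos.le, min_le_left _ _, isPostDelay_of_tied ht hpos hgap, untied _ hpos hgap⟩
    · have hgap : ∀ h, val a < val h → d < val h - val a := fun h hh => absurd ⟨h, hh⟩ hup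
      exact ⟨d, hd.le, le_rfl, isPostDelay_of_tied ht hd hgap, untied _ hd hgap⟩
  · by_cases hup : ∃ g, val a < val g
    · obtain ⟨g₀, h₀, hmin⟩ := exists_next hup
      rcases lt_or_ge d (val g₀ - val a) with hlt | hge
      · exact Or.inl (isSameDelay_of_not_tied ht hd.le fun h hh => by linarith [hmin h hh])
      · refine Or.inr ⟨_, by linarith, hge, isPostDelay_of_not_tied ht h₀ hmin, ?_⟩
        have hlt : {h | delayed val a (val g₀ - val a) a < delayed val a (val g₀ - val a) h} ⊂
            {h | val a < val h} := by
          refine (Set.ssubset_iff_of_subset (upper_delayed_subset (by linarith))).2 ⟨g₀, h₀, ?_⟩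
          have hne : g₀ ≠ a := by rintro rfl; exact lt_irrefl _ h₀
          simp only [Set.mem_ofPred_eq, delayed_self, delayed_of_ne _ _ _ hne]
          linarith
        have := Set.ncard_lt_ncard hlt (Set.toFinite _)
        simp only [delayRank, if_neg ht]
        split_ifs <;> omega
    · exact Or.inl (isSameDelay_of_not_tied ht hd.le fun h hh => absurd ⟨h, hh⟩ hup)

end Delay

/-! ### Classes of configurations -/

namespace ITA

open LinExpr

variable {Act Q : Type*} {n : ℕ} {Y : Fin n → Type*} {A : ITA Act Q Y}

section ZeroAbove

variable (A) in
/-- The clocks above the level of the state are zero. -/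
def ZeroAbove (s : A.Config) : Prop := ∀ z : Clock Y, A.level s.1 < z.1 → s.2 z = 0

theorem zeroAbove_initConfig : A.ZeroAbove A.initConfig := fun _ _ => rfl

variable (A) in
open Classical in
/-- The configuration reached from `s` by a time step of duration `d`. -/
noncomputable def delay (s : A.Config) (d : ℝ) : A.Config :=
  (s.1, Function.update s.2 (A.actClock s.1) (s.2 (A.actClock s.1) + d))

theorem timeStep_iff {s s' : A.Config} {d : ℝ} : A.TimeStep d s s' ↔ 0 ≤ d ∧ s' = A.delay s d :=
  Iff.rfl

theorem delay_delay (s : A.Config) (d d' : ℝ) : A.delay (A.delay s d) d' = A.delay s (d + d') := by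
  simp [delay, add_assoc]

theorem zeroAbove_delay {s : A.Config} (h : A.ZeroAbove s) (d : ℝ) :
    A.ZeroAbove (A.delay s d) := by
  intro z hz
  have hz' : A.level s.1 < z.1 := hz
  have hne : z ≠ A.actClock s.1 := by
    rintro rfl
    exact lt_irrefl _ hz'
  classical
  exact (Function.update_of_ne hne _ _).trans (h z hz')

end ZeroAbove

variable [∀ i, Fintype (Y i)]

theorem Class.ext_le {R R' : A.Class} (hs : R.state = R'.state)
    (hle : ∀ k (hk : k ≤ A.level R.state) (hk' : k ≤ A.level R'.state) (f g : A.E k),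
      R.le k hk f g ↔ R'.le k hk' f g) : R = R' := by
  obtain ⟨q, le, _, _⟩ := R
  obtain ⟨q', le', _, _⟩ := R'
  obtain rfl : q = q' := hs
  obtain rfl : le = le' := by
    funext k hk f g
    exact propext (hle k hk hk f g)
  rfl

instance [Finite Q] : Finite A.Class := by
  refine Finite.of_injective
    (β := Σ q : Q, (k : Fin n) → k ≤ A.level q → A.E k → A.E k → Prop)
    (fun R => ⟨R.state, R.le⟩) ?_
  rintro ⟨q, le, _, _⟩ ⟨q', le', _, _⟩ h
  simp only [Sigma.mk.injEq] at h
  obtain ⟨rfl, h⟩ := h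
  cases h
  rfl

variable (A) in
/-- The class given by the state of a configuration and the order of the values. It describes
the configuration if the clocks above the level of the state are zero. -/
def classOf (s : A.Config) : A.Class where
  state := s.1
  le _ _ f g := eval s.2 f.1 ≤ eval s.2 g.1
  le_total _ _ f g := le_total (eval s.2 f.1) (eval s.2 g.1)
  le_trans _ _ _ _ _ := le_trans

theorem mem_sem_iff {s : A.Config} {R : A.Class} :
    s ∈ R.sem ↔ A.ZeroAbove s ∧ R = A.classOf s := by
  constructor
  · rintro ⟨h1, h2, h3⟩
    exact ⟨h2, Class.ext_le h1.symm fun k hk hk' f g => (h3 k hk f g).symm⟩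
  · rintro ⟨h, rfl⟩
    exact ⟨rfl, h, fun k hk f g => Iff.rfl⟩

theorem existsUnique_initial : ∃! R₀ : A.Class, A.initConfig ∈ R₀.sem :=
  ⟨A.classOf A.initConfig, mem_sem_iff.2 ⟨zeroAbove_initConfig, rfl⟩,
    fun _ h => (mem_sem_iff.1 h).2⟩

/-! ### Time steps and time successors -/

variable (A) in
/-- The active clock of a state, as an element of the saturated set of its level. -/
noncomputable def actElem (q : Q) : A.E (A.level q) :=
  ⟨var (A.actClock q), Saturated.clock _ (A.act q)⟩

variable (A) in
/-- The values of the expressions of the level of the state `q`. -/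
noncomputable def levelVal (q : Q) (v : Clock Y → ℝ) (f : A.E (A.level q)) : ℝ := eval v f.1

theorem levelVal_delay (s : A.Config) (d : ℝ) :
    A.levelVal s.1 (A.delay s d).2 = delayed (A.levelVal s.1 s.2) (A.actElem s.1) d := by
  funext f
  by_cases hf : f = A.actElem s.1
  · subst hf
    rw [delayed_self]
    simp [levelVal, actElem, delay]
  · rw [delayed_of_ne _ _ _ hf]
    refine eval_congr fun x hx => ?_
    have hne : x ≠ A.actClock s.1 := by
      rintro rfl
      refine hx (Saturated.coeff_eq_zero f.2 fun h => hf (Subtype.ext h))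
    classical
    exact Function.update_of_ne hne _ _

theorem eval_delay_of_lt (s : A.Config) (d : ℝ) {k : Fin n} (hk : k < A.level s.1) (f : A.E k) :
    eval (A.delay s d).2 f.1 = eval s.2 f.1 := by
  refine eval_congr fun x hx => ?_
  have hne : x ≠ A.actClock s.1 := by
    rintro rfl
    exact hx (Saturated.coeff_eq_zero_of_lt f.2 hk)
  classical
  exact Function.update_of_ne hne _ _

theorem timeSucc_delay_iff {s : A.Config} {d : ℝ} :
    (A.classOf s).TimeSucc (A.classOf (A.delay s d)) ↔
      IsPostDelay (A.levelVal s.1 s.2) (A.actElem s.1) d := by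
  unfold IsPostDelay
  rw [← levelVal_delay]
  constructor
  · rintro ⟨-, -, h⟩ f g
    exact h le_rfl f g
  · intro h
    refine ⟨rfl, fun k hk hk' f g hlt => ?_, fun hk' f g => h f g⟩
    show eval _ _ ≤ eval _ _ ↔ eval _ _ ≤ eval _ _
    rw [eval_delay_of_lt s d hlt, eval_delay_of_lt s d hlt]

theorem classOf_delay_eq {s : A.Config} {d : ℝ}
    (h : IsSameDelay (A.levelVal s.1 s.2) (A.actElem s.1) d) :
    A.classOf (A.delay s d) = A.classOf s := by
  unfold IsSameDelay at h
  rw [← levelVal_delay] at h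
  refine Class.ext_le rfl fun k hk _ f g => ?_
  rcases (show k ≤ A.level s.1 from hk).eq_or_lt with rfl | hlt
  · exact h f g
  · show eval _ _ ≤ eval _ _ ↔ eval _ _ ≤ eval _ _
    rw [eval_delay_of_lt s d hlt, eval_delay_of_lt s d hlt]

theorem Class.TimeSucc.unique {R R₁ R₂ : A.Class} (h₁ : R.TimeSucc R₁) (h₂ : R.TimeSucc R₂) :
    R₁ = R₂ := by
  obtain ⟨q, le, _, _⟩ := R
  obtain ⟨q₁, le₁, _, _⟩ := R₁
  obtain ⟨q₂, le₂, _, _⟩ := R₂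
  obtain ⟨e₁, l₁, t₁⟩ := h₁
  obtain ⟨e₂, l₂, t₂⟩ := h₂
  simp only at e₁ e₂
  subst e₁ e₂
  refine Class.ext_le rfl fun k hk hk' f g => ?_
  rcases (show k ≤ A.level q₂ from hk).eq_or_lt with rfl | hlt
  · exact (t₁ _ f g).trans (t₂ _ f g).symm
  · exact (l₁ k hk hk f g hlt).trans (l₂ k hk hk' f g hlt).symm

/-- A class of a configuration has a time successor, reached after some delay. The delay can be
chosen in every field that contains the clock values. -/
theorem exists_delay_timeSucc (s : A.Config) (K : Subfield ℝ) (hK : ∀ z, s.2 z ∈ K) :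
    ∃ d, 0 ≤ d ∧ d ∈ K ∧ (A.classOf s).TimeSucc (A.classOf (A.delay s d)) := by
  obtain ⟨d, h0, hd, h⟩ := exists_isPostDelay (val := A.levelVal s.1 s.2) (a := A.actElem s.1) K
    (fun f => eval_mem _ K hK f.1)
  exact ⟨d, h0, hd, timeSucc_delay_iff.2 h⟩

theorem reflTransGen_timeSucc_delay (s : A.Config) {d : ℝ} (hd : 0 ≤ d) :
    Relation.ReflTransGen Class.TimeSucc (A.classOf s) (A.classOf (A.delay s d)) := by
  induction hm : delayRank (A.levelVal s.1 s.2) (A.actElem s.1) using Nat.strong_induction_on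
    generalizing s d with
  | _ m ih =>
  subst hm
  rcases isSameDelay_or_exists_isPostDelay (val := A.levelVal s.1 s.2) (a := A.actElem s.1) hd with
    h | ⟨d₁, h0, h1, hpost, hlt⟩
  · rw [classOf_delay_eq h]
  · refine Relation.ReflTransGen.head (timeSucc_delay_iff.2 hpost) ?_
    rw [← levelVal_delay] at hlt
    have := ih _ hlt (A.delay s d₁) (sub_nonneg.2 h1) rfl
    rwa [delay_delay, add_sub_cancel] at this

/-! ### Discrete steps -/

theorem classOf_le_iff {s t : A.Config} (hst : A.classOf s = A.classOf t) {k : Fin n}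
    (hk : k ≤ A.level s.1) {f g : LinExpr (Clock Y)} (hf : A.Saturated k f)
    (hg : A.Saturated k g) : eval s.2 f ≤ eval s.2 g ↔ eval t.2 f ≤ eval t.2 g := by
  obtain ⟨q, v⟩ := s
  obtain ⟨q', w⟩ := t
  obtain rfl : q = q' := congrArg Class.state hst
  have h1 : (A.classOf (q, v)).le = (A.classOf (q, w)).le := by
    injection hst with _ h
  exact Iff.of_eq (congrFun (congrFun (congrFun (congrFun h1 k) hk) ⟨f, hf⟩) ⟨g, hg⟩)

/-- Configurations in the same class agree on the sign of every expression whose bound for some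
clock of level `k` belongs to `E_k`. -/
theorem sign_iff {s t : A.Config} (hst : A.classOf s = A.classOf t) {k : Fin n}
    (hk : k ≤ A.level s.1) {y : Option (Y k)} {C : LinExpr (Clock Y)}
    (hC : A.Saturated k (C.bound ⟨k, y⟩)) :
    (eval s.2 C ≤ 0 ↔ eval t.2 C ≤ 0) ∧ (0 ≤ eval s.2 C ↔ 0 ≤ eval t.2 C) := by
  have hle : ∀ f g : A.E k, eval s.2 f.1 ≤ eval s.2 g.1 ↔ eval t.2 f.1 ≤ eval t.2 g.1 :=
    fun f g => classOf_le_iff hst hk f.2 g.2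
  set B : A.E k := ⟨C.bound ⟨k, y⟩, hC⟩
  set O : A.E k := ⟨0, Saturated.zero k⟩
  set Z : A.E k := ⟨var ⟨k, y⟩, Saturated.clock k y⟩
  by_cases h0 : C.1 ⟨k, y⟩ = 0
  · have hB : ∀ v : Clock Y → ℝ, eval v B.1 = -eval v C := fun v => by
      rw [← eval_neg, ← bound_of_coeff_eq_zero h0]
    have h1 := hle B O
    have h2 := hle O B
    simp only [hB, O, eval_zero, Left.neg_nonpos_iff, Left.nonneg_neg_iff] at h1 h2
    exact ⟨h2, h1⟩
  · have hB : ∀ v : Clock Y → ℝ, eval v C = C.1 ⟨k, y⟩ * (eval v Z.1 - eval v B.1) := fun v => by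
      conv_lhs => rw [eq_smul_sub_bound h0]
      rw [eval_smul, eval_sub]
    have h1 := hle B Z
    have h2 := hle Z B
    simp only [hB]
    rcases lt_or_gt_of_ne h0 with hneg | hpos
    · have hneg' : (C.1 ⟨k, y⟩ : ℝ) < 0 := by exact_mod_cast hneg
      simp only [mul_nonpos_iff, mul_nonneg_iff, hneg'.le, not_le.2 hneg', sub_nonneg,
        sub_nonpos, false_and, true_and, false_or, h1, h2, and_self]
    · have hpos' : (0 : ℝ) < C.1 ⟨k, y⟩ := by exact_mod_cast hpos
      simp only [mul_nonpos_iff, mul_nonneg_iff, hpos'.le, not_le.2 hpos', sub_nonneg,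
        sub_nonpos, false_and, true_and, or_false, h1, h2, and_self]

theorem holds_iff_of_sign {r r' : ℝ} (h : (r ≤ 0 ↔ r' ≤ 0) ∧ (0 ≤ r ↔ 0 ≤ r')) (c : Cmp) :
    c.holds r ↔ c.holds r' := by
  obtain ⟨h1, h2⟩ := h
  cases c
  · simp only [Cmp.holds, gt_iff_lt, ← not_le, h1]
  · exact h2
  · simp only [Cmp.holds, le_antisymm_iff, h1, h2]
  · exact h1
  · simp only [Cmp.holds, ← not_le, h2]

theorem guard_iff {s t : A.Config} (hst : A.classOf s = A.classOf t)
    {e : Transition Act Q (Clock Y)} (he : e ∈ A.trans) (hs : s.1 = e.src)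
    {c : LinExpr (Clock Y) × Cmp} (hc : c ∈ e.guard) :
    c.2.holds (eval s.2 c.1) ↔ c.2.holds (eval t.2 c.1) := by
  refine holds_iff_of_sign ?_ _
  rcases A.guard_ok e he c hc with ⟨y, h⟩ | ⟨y, y', h⟩
  · exact sign_iff hst (by rw [hs]) (Saturated.guard y he hc h)
  · have hk : A.level e.src ≤ A.level s.1 := by rw [hs]
    have h1 := classOf_le_iff hst hk (Saturated.clock _ y) (Saturated.clock _ y')
    have h2 := classOf_le_iff hst hk (Saturated.clock _ y') (Saturated.clock _ y)
    rw [h]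
    simp only [eval_sub, sub_nonneg, sub_nonpos]
    exact ⟨h1, h2⟩

variable (A) in
/-- The configuration reached by the update of a transition. -/
noncomputable def fire (e : Transition Act Q (Clock Y)) (s : A.Config) : A.Config :=
  (e.tgt, fun z => (e.update z).eval s.2)

theorem zeroAbove_fire {e : Transition Act Q (Clock Y)} (he : e ∈ A.trans) {s : A.Config}
    (hs : s.1 = e.src) (h : A.ZeroAbove s) : A.ZeroAbove (A.fire e s) := by
  intro z hz
  have hz' : A.level e.tgt < z.1 := hz
  show eval s.2 (e.update z) = 0
  by_cases hz2 : z.1 ≤ A.level e.src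
  · rw [A.update_reset he hz2 hz', eval_zero]
  · rw [A.update_above he (not_le.1 hz2), eval_var]
    exact h z (by rw [hs]; exact not_le.1 hz2)

/-- The order after a discrete step is that of the substituted expressions before it. At levels up to
the level of the source these belong to the saturated set; at higher levels the sign of their
difference is determined by its bound for the main clock of the level of the source. -/
theorem classOf_fire_eq {e : Transition Act Q (Clock Y)} (he : e ∈ A.trans) {s t : A.Config}
    (hs : s.1 = e.src) (hs0 : A.ZeroAbove s) (ht0 : A.ZeroAbove t)
    (hst : A.classOf s = A.classOf t) : A.classOf (A.fire e s) = A.classOf (A.fire e t) := by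
  refine Class.ext_le rfl fun k hk _ f g => ?_
  have hk : k ≤ A.level e.tgt := hk
  have hts : t.1 = e.src := (congrArg Class.state hst).symm.trans hs
  show eval (fun z => (e.update z).eval s.2) f.1 ≤ eval (fun z => (e.update z).eval s.2) g.1 ↔
    eval (fun z => (e.update z).eval t.2) f.1 ≤ eval (fun z => (e.update z).eval t.2) g.1
  simp only [← eval_subst]
  by_cases hks : k ≤ A.level e.src
  · exact classOf_le_iff hst (by rwa [hs]) (Saturated.update he hks hk f.2)
      (Saturated.update he hks hk g.2)
  · by_cases hfg : f = g
    · subst hfg; simp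
    have hlt := not_le.1 hks
    have := (sign_iff hst (by rw [hs]) (Saturated.cross he hlt hk f.2 g.2
      fun h => hfg (Subtype.ext h))).1
    rwa [eval_truncate (fun z hz => hs0 z (by rwa [hs])),
      eval_truncate (fun z hz => ht0 z (by rwa [hts])), eval_sub, eval_sub, sub_nonpos,
      sub_nonpos] at this

variable (A) in
/-- The guard of `e` is satisfied in `s`, and `e` leaves the state of `s`. -/
def Enabled (e : Transition Act Q (Clock Y)) (s : A.Config) : Prop :=
  s.1 = e.src ∧ ∀ c ∈ e.guard, c.2.holds (c.1.eval s.2)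

theorem discreteStep_iff {e : Fin A.trans.length} {s s' : A.Config} :
    A.DiscreteStep e s s' ↔ A.Enabled A.trans[e] s ∧ s' = A.fire A.trans[e] s :=
  and_assoc.symm

/-- A discrete edge from the class of `s` is realized by a step from `s` itself. -/
theorem discreteEdge_classOf_iff {e : Fin A.trans.length} {s : A.Config} (hs : A.ZeroAbove s)
    {R : A.Class} : Class.DiscreteEdge e (A.classOf s) R ↔
      A.Enabled A.trans[e] s ∧ R = A.classOf (A.fire A.trans[e] s) := by
  have he : A.trans[e] ∈ A.trans := List.getElem_mem _
  constructor
  · rintro ⟨t, ht, t', ht', hstep⟩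
    obtain ⟨ht0, hts⟩ := mem_sem_iff.1 ht
    obtain ⟨ht0', rfl⟩ := mem_sem_iff.1 ht'
    obtain ⟨⟨hsrc, hg⟩, rfl⟩ := discreteStep_iff.1 hstep
    have hsrc' : s.1 = A.trans[e].src := (congrArg Class.state hts).trans hsrc
    exact ⟨⟨hsrc', fun c hc => (guard_iff hts he hsrc' hc).2 (hg c hc)⟩,
      (classOf_fire_eq he hsrc' hs ht0 hts).symm⟩
  · rintro ⟨h, rfl⟩
    exact ⟨s, mem_sem_iff.2 ⟨hs, rfl⟩, _, mem_sem_iff.2 ⟨zeroAbove_fire he h.1 hs, rfl⟩,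
      discreteStep_iff.2 ⟨h, rfl⟩⟩

variable (A) in
theorem isBisimulation_sem : IsBisimulation A.abstractStep Class.abstractStep
    (fun (s : A.Config) (R : A.Class) => s ∈ R.sem) := by
  intro s R hsR
  obtain ⟨hs, rfl⟩ := mem_sem_iff.1 hsR
  constructor
  · rintro (_ | e) s' h
    · obtain ⟨d, hd, rfl⟩ := h
      exact ⟨_, reflTransGen_timeSucc_delay s hd, mem_sem_iff.2 ⟨zeroAbove_delay hs d, rfl⟩⟩
    · obtain ⟨hen, rfl⟩ := discreteStep_iff.1 h
      exact ⟨_, (discreteEdge_classOf_iff hs).2 ⟨hen, rfl⟩,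
        mem_sem_iff.2 ⟨zeroAbove_fire (List.getElem_mem _) hen.1 hs, rfl⟩⟩
  · rintro (_ | e) R' h
    · replace h : Relation.ReflTransGen Class.TimeSucc (A.classOf s) R' := h
      have : ∃ d, 0 ≤ d ∧ R' = A.classOf (A.delay s d) := by
        clear hsR
        induction h with
        | refl => exact ⟨0, le_rfl, by simp [delay]⟩
        | @tail R₁ R₂ _ h2 ih =>
          obtain ⟨d, hd, rfl⟩ := ih
          obtain ⟨d', hd', -, h'⟩ := exists_delay_timeSucc (A.delay s d) ⊤ (fun _ => trivial)
          exact ⟨d + d', add_nonneg hd hd', by rw [← delay_delay]; exact h2.unique h'⟩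
      obtain ⟨d, hd, rfl⟩ := this
      exact ⟨_, ⟨d, hd, rfl⟩, mem_sem_iff.2 ⟨zeroAbove_delay hs d, rfl⟩⟩
    · obtain ⟨hen, rfl⟩ := (discreteEdge_classOf_iff hs).1 h
      exact ⟨_, discreteStep_iff.2 ⟨hen, rfl⟩,
        mem_sem_iff.2 ⟨zeroAbove_fire (List.getElem_mem _) hen.1 hs, rfl⟩⟩

/-! ### The untimed language -/

theorem map_fst_timedWord (t : ℝ) (l : List (ℝ × Option Act)) :
    (timedWord t l).map Prod.fst = (l.map Prod.snd).reduceOption := by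
  induction l generalizing t with
  | nil => rfl
  | cons p l ih =>
    obtain ⟨d, _ | a⟩ := p
    · exact ih _
    · simp [timedWord, ih, List.reduceOption_cons_of_some]

theorem mem_untimedLanguage_iff {w : List Act} : w ∈ A.untimedLanguage ↔
    ∃ l s, A.Run A.initConfig l s ∧ s.1 ∈ A.final ∧ w = (l.map Prod.snd).reduceOption := by
  constructor
  · rintro ⟨_, ⟨l, s, h1, h2, rfl⟩, rfl⟩
    exact ⟨l, s, h1, h2, map_fst_timedWord 0 l⟩
  · rintro ⟨l, s, h1, h2, rfl⟩
    exact ⟨_, ⟨l, s, h1, h2, rfl⟩, (map_fst_timedWord 0 l).symm⟩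

theorem exists_path_of_reflTransGen {R R' R'' : A.Class} {x : List (Option Act)}
    (h : Relation.ReflTransGen Class.TimeSucc R R') (h' : A.classAutomaton.IsPath R' R'' x) :
    ∃ x', A.classAutomaton.IsPath R R'' x' ∧ x'.reduceOption = x.reduceOption := by
  induction h using Relation.ReflTransGen.head_induction_on with
  | refl => exact ⟨x, h', rfl⟩
  | @head R₁ R₂ h1 _ ih =>
    obtain ⟨x', hx', hx⟩ := ih
    exact ⟨none :: x', .cons _ _ _ _ _ (Or.inl ⟨rfl, h1⟩) hx', by
      rw [List.reduceOption_cons_of_none, hx]⟩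

theorem Run.exists_path {s s' : A.Config} {l : List (ℝ × Option Act)} (h : A.Run s l s') :
    A.ZeroAbove s → ∃ x, A.classAutomaton.IsPath (A.classOf s) (A.classOf s') x ∧
      x.reduceOption = (l.map Prod.snd).reduceOption := by
  induction h with
  | nil s => exact fun _ => ⟨[], .nil _, rfl⟩
  | @cons s s₁ s₂ s' d e l ht hd _ ih =>
    intro hs
    obtain ⟨hd0, rfl⟩ := timeStep_iff.1 ht
    obtain ⟨hen, rfl⟩ := discreteStep_iff.1 hd
    have hs₁ := zeroAbove_delay hs d
    obtain ⟨x, hx, hxl⟩ := ih (zeroAbove_fire (List.getElem_mem _) hen.1 hs₁)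
    have hedge : Class.DiscreteEdge e (A.classOf (A.delay s d)) _ :=
      (discreteEdge_classOf_iff hs₁).2 ⟨hen, rfl⟩
    obtain ⟨x', hx', hx'l⟩ := exists_path_of_reflTransGen (reflTransGen_timeSucc_delay s hd0)
      (.cons _ _ _ A.trans[e].action x (Or.inr ⟨e, rfl, hedge⟩) hx)
    refine ⟨x', hx', hx'l.trans ?_⟩
    rcases h : A.trans[e].action with _ | a
    · rw [List.map_cons, List.reduceOption_cons_of_none, List.reduceOption_cons_of_none, hxl]
    · rw [List.map_cons, List.reduceOption_cons_of_some, List.reduceOption_cons_of_some, hxl]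

theorem exists_run_of_path {R R' : A.Class} {x : List (Option Act)}
    (h : A.classAutomaton.IsPath R R' x) {s : A.Config} (hs : A.ZeroAbove s)
    (hR : R = A.classOf s) :
    ∃ l s', A.Run s l s' ∧ s'.1 = R'.state ∧
      x.reduceOption = (l.map Prod.snd).reduceOption := by
  induction h generalizing s with
  | nil R => exact ⟨[], s, .nil s, by rw [hR]; rfl, rfl⟩
  | cons R₁ R R' a x hstep _ ih =>
    subst hR
    rcases hstep with ⟨rfl, hsucc⟩ | ⟨e, rfl, hedge⟩
    · obtain ⟨d, hd, -, h⟩ := exists_delay_timeSucc s ⊤ (fun _ => trivial)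
      obtain ⟨l, s', hrun, hs', hl⟩ := ih (zeroAbove_delay hs d) (hsucc.unique h)
      rw [List.reduceOption_cons_of_none, hl]
      -- The delay is merged with the first time step of the run; an empty run needs no delay.
      rcases hrun with _ | ⟨ht, hdisc, hrest⟩
      · exact ⟨[], s, .nil s, hs', rfl⟩
      · obtain ⟨hd', rfl⟩ := timeStep_iff.1 ht
        rw [delay_delay] at hdisc
        exact ⟨_, s', .cons ⟨add_nonneg hd hd', rfl⟩ hdisc hrest, hs', rfl⟩
    · obtain ⟨hen, rfl⟩ := (discreteEdge_classOf_iff hs).1 hedge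
      obtain ⟨l, s', hrun, hs', hl⟩ :=
        ih (zeroAbove_fire (List.getElem_mem _) hen.1 hs) rfl
      refine ⟨_, s', .cons (d := 0) ⟨le_rfl, by simp⟩ (discreteStep_iff.2 ⟨hen, rfl⟩) hrun,
        hs', ?_⟩
      rcases h : A.trans[e].action with _ | a
      · rw [List.map_cons, List.reduceOption_cons_of_none, List.reduceOption_cons_of_none, hl]
      · rw [List.map_cons, List.reduceOption_cons_of_some, List.reduceOption_cons_of_some, hl]

variable (A) in
theorem accepts_classAutomaton : A.classAutomaton.accepts = A.untimedLanguage := by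
  ext w
  rw [εNFA.mem_accepts_iff_exists_path, mem_untimedLanguage_iff]
  constructor
  · rintro ⟨R, R', x, hR, hR', rfl, hpath⟩
    obtain ⟨l, s, h1, h2, h3⟩ := exists_run_of_path hpath zeroAbove_initConfig (mem_sem_iff.1 hR).2
    exact ⟨l, s, h1, by rw [h2]; exact hR', h3⟩
  · rintro ⟨l, s, h1, h2, rfl⟩
    obtain ⟨x, hx, hxl⟩ := h1.exists_path zeroAbove_initConfig
    exact ⟨_, _, x, mem_sem_iff.2 ⟨zeroAbove_initConfig, rfl⟩, h2, hxl, hx⟩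

variable (A) in
theorem isRegular_untimedLanguage [Finite Q] : A.untimedLanguage.IsRegular := by
  have := Fintype.ofFinite A.Class
  rw [← accepts_classAutomaton]
  exact Language.isRegular_iff.2 ⟨Set A.Class, inferInstance, A.classAutomaton.toNFA.toDFA, by
    rw [NFA.toDFA_correct, εNFA.toNFA_correct]⟩

end ITA

/-! ### A calculus of primitive recursive functions

With the composition rules below, `fun_prop` shows that explicitly given functions on codes are
primitive recursive. -/

attribute [fun_prop] Primrec

namespace Primrec

section Rules

variable {α β γ σ : Type*} [Primcodable α] [Primcodable β] [Primcodable γ] [Primcodable σ]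

@[fun_prop] theorem fun_id : Primrec fun x : α => x := Primrec.id

@[fun_prop] theorem fun_const (c : β) : Primrec fun _ : α => c := Primrec.const c

@[fun_prop] theorem fun_comp {f : β → γ} {g : α → β} (hf : Primrec f) (hg : Primrec g) :
    Primrec fun x => f (g x) := hf.comp hg

@[fun_prop] theorem fun_fst {f : α → β × γ} (hf : Primrec f) : Primrec fun x => (f x).1 :=
  Primrec.fst.comp hf

@[fun_prop] theorem fun_snd {f : α → β × γ} (hf : Primrec f) : Primrec fun x => (f x).2 :=
  Primrec.snd.comp hf

@[fun_prop] theorem fun_pair {f : α → β} {g : α → γ} (hf : Primrec f) (hg : Primrec g) :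
    Primrec fun x => (f x, g x) := hf.pair hg

@[fun_prop] theorem fun_some {f : α → β} (hf : Primrec f) : Primrec fun x => some (f x) :=
  Primrec.option_some.comp hf

@[fun_prop] theorem fun_cond {b : α → Bool} {f g : α → β} (hb : Primrec b) (hf : Primrec f)
    (hg : Primrec g) : Primrec fun x => bif b x then f x else g x := Primrec.cond hb hf hg

@[fun_prop] theorem fun_and {f g : α → Bool} (hf : Primrec f) (hg : Primrec g) :
    Primrec fun x => f x && g x := Primrec.and.comp hf hg

@[fun_prop] theorem fun_or {f g : α → Bool} (hf : Primrec f) (hg : Primrec g) :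
    Primrec fun x => f x || g x := Primrec.or.comp hf hg

@[fun_prop] theorem fun_not {f : α → Bool} (hf : Primrec f) : Primrec fun x => !f x :=
  Primrec.not.comp hf

@[fun_prop] theorem fun_decide_eq [DecidableEq β] {f g : α → β} (hf : Primrec f)
    (hg : Primrec g) : Primrec fun x => decide (f x = g x) := Primrec.eq.decide.comp hf hg

@[fun_prop] theorem fun_decide_le {f g : α → ℕ} (hf : Primrec f) (hg : Primrec g) :
    Primrec fun x => decide (f x ≤ g x) := Primrec.nat_le.decide.comp hf hg

@[fun_prop] theorem fun_decide_lt {f g : α → ℕ} (hf : Primrec f) (hg : Primrec g) :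
    Primrec fun x => decide (f x < g x) := Primrec.nat_lt.decide.comp hf hg

@[fun_prop] theorem fun_nat_add {f g : α → ℕ} (hf : Primrec f) (hg : Primrec g) :
    Primrec fun x => f x + g x := Primrec.nat_add.comp hf hg

@[fun_prop] theorem fun_nat_mul {f g : α → ℕ} (hf : Primrec f) (hg : Primrec g) :
    Primrec fun x => f x * g x := Primrec.nat_mul.comp hf hg

@[fun_prop] theorem fun_append {f g : α → List β} (hf : Primrec f) (hg : Primrec g) :
    Primrec fun x => f x ++ g x := Primrec.list_append.comp hf hg

@[fun_prop] theorem fun_cons {f : α → β} {g : α → List β} (hf : Primrec f) (hg : Primrec g) :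
    Primrec fun x => f x :: g x := Primrec.list_cons.comp hf hg

@[fun_prop] theorem fun_length {f : α → List β} (hf : Primrec f) :
    Primrec fun x => (f x).length := Primrec.list_length.comp hf

@[fun_prop] theorem fun_range {f : α → ℕ} (hf : Primrec f) :
    Primrec fun x => List.range (f x) := Primrec.list_range.comp hf

@[fun_prop] theorem fun_getD {f : α → List β} {g : α → ℕ} {d : α → β} (hf : Primrec f)
    (hg : Primrec g) (hd : Primrec d) : Primrec fun x => (f x).getD (g x) (d x) := by
  simp only [List.getD_eq_getElem?_getD]
  exact Primrec.option_getD.comp (Primrec.list_getElem?.comp hf hg) hd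

@[fun_prop] theorem fun_map {f : α → List β} {g : α → β → γ} (hf : Primrec f)
    (hg : Primrec fun p : α × β => g p.1 p.2) : Primrec fun x => (f x).map (g x) :=
  Primrec.list_map hf hg

@[fun_prop] theorem fun_flatMap {f : α → List β} {g : α → β → List γ} (hf : Primrec f)
    (hg : Primrec fun p : α × β => g p.1 p.2) : Primrec fun x => (f x).flatMap (g x) :=
  Primrec.list_flatMap hf hg

@[fun_prop] theorem fun_foldr {f : α → List β} {g : α → σ} {h : α → β → σ → σ} (hf : Primrec f)
    (hg : Primrec g) (hh : Primrec fun p : α × β × σ => h p.1 p.2.1 p.2.2) :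
    Primrec fun x => (f x).foldr (h x) (g x) :=
  Primrec.list_foldr (h := fun x p => h x p.1 p.2) hf hg hh

@[fun_prop] theorem fun_filter {f : α → List β} {g : α → β → Bool} (hf : Primrec f)
    (hg : Primrec fun p : α × β => g p.1 p.2) : Primrec fun x => (f x).filter (g x) := by
  have : (fun x => (f x).filter (g x)) =
      fun x => (f x).flatMap fun y => bif g x y then [y] else [] := by
    funext x
    induction f x with
    | nil => rfl
    | cons a l ih => cases h : g x a <;> simp [h, ih]
  rw [this]
  fun_prop

@[fun_prop] theorem fun_all {f : α → List β} {g : α → β → Bool} (hf : Primrec f)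
    (hg : Primrec fun p : α × β => g p.1 p.2) : Primrec fun x => (f x).all (g x) := by
  have : (fun x => (f x).all (g x)) = fun x => (f x).foldr (fun y b => g x y && b) true := by
    funext x
    induction f x with
    | nil => rfl
    | cons a l ih => simp [ih]
  rw [this]
  refine fun_foldr hf (fun_const _) (fun_and ?_ (by fun_prop))
  exact hg.comp (Primrec.fst.pair (Primrec.fst.comp Primrec.snd))

@[fun_prop] theorem fun_any {f : α → List β} {g : α → β → Bool} (hf : Primrec f)
    (hg : Primrec fun p : α × β => g p.1 p.2) : Primrec fun x => (f x).any (g x) := by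
  have : (fun x => (f x).any (g x)) = fun x => !(f x).all fun y => !g x y := by
    funext x
    simp [List.not_all_eq_any_not]
  rw [this]
  fun_prop

theorem fun_iterate {f : α → ℕ} {g : α → β} {h : α → β → β} (hf : Primrec f) (hg : Primrec g)
    (hh : Primrec fun p : α × β => h p.1 p.2) : Primrec fun x => (h x)^[f x] (g x) :=
  Primrec.nat_iterate hf hg hh

end Rules

section Int

variable {α : Type*} [Primcodable α]

theorem int_ofNat : Primrec fun k : ℕ => (k : ℤ) := by
  rw [← Primrec.encode_iff]
  exact Primrec.nat_double

theorem int_negSucc : Primrec Int.negSucc := by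
  rw [← Primrec.encode_iff]
  exact Primrec.nat_double_succ

theorem int_toNat : Primrec Int.toNat := by
  rw [Primrec.ofNat_iff]
  refine (Primrec.cond (c := fun k : ℕ => k.bodd) Primrec.nat_bodd (Primrec.const 0)
    Primrec.nat_div2).of_eq fun k => ?_
  have : Denumerable.ofNat ℤ k = Equiv.intEquivNat.symm k := rfl
  rw [this]
  cases h : k.bodd <;> simp [Equiv.intEquivNat, Equiv.natSumNatEquivNat,
    Equiv.boolProdNatEquivNat, Equiv.intEquivNatSumNat, h]

theorem int_neg_toNat : Primrec fun z : ℤ => (-z).toNat := by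
  rw [Primrec.ofNat_iff]
  refine (Primrec.cond (c := fun k : ℕ => k.bodd) Primrec.nat_bodd
    (Primrec.succ.comp Primrec.nat_div2) (Primrec.const 0)).of_eq fun k => ?_
  have : Denumerable.ofNat ℤ k = Equiv.intEquivNat.symm k := rfl
  rw [this]
  cases h : k.bodd <;> simp [Equiv.intEquivNat, Equiv.natSumNatEquivNat,
    Equiv.boolProdNatEquivNat, Equiv.intEquivNatSumNat, h]

/-- Arithmetic on integers is reduced to that on natural numbers by writing an integer as the
difference of its positive and negative parts; this is the way back. -/
theorem int_sub_nat {f g : α → ℕ} (hf : Primrec f) (hg : Primrec g) :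
    Primrec fun x => (f x : ℤ) - (g x : ℤ) := by
  have : (fun x => (f x : ℤ) - (g x : ℤ)) = fun x =>
      bif decide (g x ≤ f x) then ((f x - g x : ℕ) : ℤ) else Int.negSucc (g x - f x - 1) := by
    funext x
    by_cases h : g x ≤ f x
    · simp [h]
    · simp [h, Int.negSucc_eq]; omega
  rw [this]
  have := int_ofNat
  have := int_negSucc
  have h1 : Primrec fun x => f x - g x := Primrec.nat_sub.comp hf hg
  have h2 : Primrec fun x => g x - f x - 1 :=
    Primrec.nat_sub.comp (Primrec.nat_sub.comp hg hf) (Primrec.const 1)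
  fun_prop

@[fun_prop] theorem fun_toNat {f : α → ℤ} (hf : Primrec f) :
    Primrec fun x => (f x).toNat := int_toNat.comp hf

theorem fun_neg_toNat {f : α → ℤ} (hf : Primrec f) :
    Primrec fun x => (-f x).toNat := int_neg_toNat.comp hf

@[fun_prop] theorem fun_int_neg {f : α → ℤ} (hf : Primrec f) :
    Primrec fun x => -f x :=
  (int_sub_nat (fun_neg_toNat hf) (fun_toNat hf)).of_eq fun x => by omega

@[fun_prop] theorem fun_natAbs {f : α → ℤ} (hf : Primrec f) :
    Primrec fun x => (f x).natAbs :=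
  (fun_nat_add (fun_toNat hf) (fun_neg_toNat hf)).of_eq fun x => by omega

@[fun_prop] theorem fun_decide_nonneg {f : α → ℤ} (hf : Primrec f) :
    Primrec fun x => decide (0 ≤ f x) :=
  (fun_decide_le (fun_neg_toNat hf) (fun_const 0)).of_eq fun x => by
    simp only [decide_eq_decide]; omega

@[fun_prop] theorem fun_int_add {f g : α → ℤ} (hf : Primrec f) (hg : Primrec g) :
    Primrec fun x => f x + g x :=
  (int_sub_nat (fun_nat_add (fun_toNat hf) (fun_toNat hg))
    (fun_nat_add (fun_neg_toNat hf) (fun_neg_toNat hg))).of_eq fun x => by omega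

@[fun_prop] theorem fun_int_mul {f g : α → ℤ} (hf : Primrec f) (hg : Primrec g) :
    Primrec fun x => f x * g x := by
  have h1 := fun_toNat hf
  have h2 := fun_neg_toNat hf
  have h3 := fun_toNat hg
  have h4 := fun_neg_toNat hg
  refine (int_sub_nat
    (f := fun x => (f x).toNat * (g x).toNat + (-f x).toNat * (-g x).toNat)
    (g := fun x => (f x).toNat * (-g x).toNat + (-f x).toNat * (g x).toNat)
    (by fun_prop) (by fun_prop)).of_eq fun x => ?_
  have e1 : f x = (f x).toNat - (-f x).toNat := by omega
  have e2 : g x = (g x).toNat - (-g x).toNat := by omega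
  conv_rhs => rw [e1, e2]
  push_cast
  ring

end Int

@[fun_prop] theorem fun_int_ofNat {α : Type*} [Primcodable α] {f : α → ℕ} (hf : Primrec f) :
    Primrec fun x => (f x : ℤ) := int_ofNat.comp hf

end Primrec

/-! ### Arithmetic of fractions

All operations are total on codes: a fraction with denominator zero stands for `0`, as division by
zero does, and the operations respect this. -/

namespace RatCode

/-- Sum of fractions. -/
def add (r s : RatCode) : RatCode :=
  bif decide (r.2 = 0) then s else bif decide (s.2 = 0) then r
    else (r.1 * (s.2 : ℤ) + s.1 * (r.2 : ℤ), r.2 * s.2)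

/-- Product of fractions. -/
def mul (r s : RatCode) : RatCode := (r.1 * s.1, r.2 * s.2)

/-- Opposite of a fraction. -/
def neg (r : RatCode) : RatCode := (-r.1, r.2)

/-- Inverse of a fraction. -/
def inv (r : RatCode) : RatCode :=
  (bif decide (0 ≤ r.1) then (r.2 : ℤ) else -(r.2 : ℤ), r.1.natAbs)

/-- The fraction denotes `0`. -/
def isZero (r : RatCode) : Bool := decide (r.1 = 0) || decide (r.2 = 0)

/-- Comparison of the values of fractions. -/
def le (r s : RatCode) : Bool :=
  decide (0 ≤ (add s (neg r)).1) || decide ((add s (neg r)).2 = 0)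

theorem value_add (r s : RatCode) : (add r s).value = r.value + s.value := by
  obtain ⟨a, b⟩ := r
  obtain ⟨c, d⟩ := s
  by_cases hb : b = 0
  · simp [add, value, hb]
  by_cases hd : d = 0
  · simp [add, value, hb, hd]
  have hb' : (b : ℚ) ≠ 0 := by exact_mod_cast hb
  have hd' : (d : ℚ) ≠ 0 := by exact_mod_cast hd
  simp only [add, value, hb, hd, decide_false, cond_false]
  push_cast
  field_simp

theorem value_mul (r s : RatCode) : (mul r s).value = r.value * s.value := by
  simp only [mul, value]
  push_cast
  rw [mul_div_mul_comm]

theorem value_neg (r : RatCode) : (neg r).value = -r.value := by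
  simp only [neg, value]
  push_cast
  rw [neg_div]

theorem value_inv (r : RatCode) : (inv r).value = r.value⁻¹ := by
  obtain ⟨a, b⟩ := r
  simp only [inv, value, inv_div]
  rw [Nat.cast_natAbs]
  by_cases h : 0 ≤ a
  · simp [h, abs_of_nonneg h]
  · simp [h, abs_of_neg (not_le.1 h), neg_div_neg_eq]

theorem isZero_iff (r : RatCode) : isZero r = true ↔ r.value = 0 := by
  simp [isZero, value]

theorem nonneg_value_iff (r : RatCode) : 0 ≤ r.value ↔ 0 ≤ r.1 ∨ r.2 = 0 := by
  obtain ⟨a, b⟩ := r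
  rcases Nat.eq_zero_or_pos b with rfl | hb
  · simp [value]
  · have hb' : (0 : ℚ) < b := by exact_mod_cast hb
    simp only [value, hb.ne', or_false]
    rw [div_nonneg_iff]
    constructor
    · rintro (h | h)
      · exact_mod_cast h.1
      · exact absurd h.2 (not_le.2 hb')
    · intro h
      exact Or.inl ⟨by exact_mod_cast h, hb'.le⟩

theorem le_iff (r s : RatCode) : le r s = true ↔ r.value ≤ s.value := by
  rw [← sub_nonneg, sub_eq_add_neg, ← value_neg, ← value_add, nonneg_value_iff]
  simp [le]

@[simp] theorem value_ratCode (q : ℚ) : (ratCode q).value = q := Rat.num_div_den q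

section Primrec

variable {α : Type*} [Primcodable α] {f g : α → RatCode}

@[fun_prop] theorem primrec_add (hf : Primrec f) (hg : Primrec g) :
    Primrec fun x => add (f x) (g x) := by
  unfold add; fun_prop

@[fun_prop] theorem primrec_mul (hf : Primrec f) (hg : Primrec g) :
    Primrec fun x => mul (f x) (g x) := by
  unfold mul; fun_prop

@[fun_prop] theorem primrec_neg (hf : Primrec f) : Primrec fun x => neg (f x) := by
  unfold neg; fun_prop

@[fun_prop] theorem primrec_inv (hf : Primrec f) : Primrec fun x => inv (f x) := by
  unfold inv; fun_prop

@[fun_prop] theorem primrec_isZero (hf : Primrec f) : Primrec fun x => isZero (f x) := by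
  unfold isZero; fun_prop

@[fun_prop] theorem primrec_le (hf : Primrec f) (hg : Primrec g) :
    Primrec fun x => le (f x) (g x) := by
  unfold le; fun_prop

end Primrec

end RatCode

/-! ### Computing with codes of expressions -/

namespace LinCode

/-- The clocks as pairs of a level and a position in it, for the list of the numbers of auxiliary
clocks. -/
def clocks (ys : List ℕ) : List (ℕ × ℕ) :=
  (List.range ys.length).flatMap fun i => (List.range (ys.getD i 0 + 1)).map fun j => (i, j)

/-- The family of the values of a function on the clocks. -/
def tabulate {β : Type*} (ys : List ℕ) (F : ℕ × ℕ → β) : List (List β) :=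
  (List.range ys.length).map fun i => (List.range (ys.getD i 0 + 1)).map fun j => F (i, j)

/-- A member of a family of fractions. -/
def coef (l : List (List RatCode)) (z : ℕ × ℕ) : RatCode := (l.getD z.1 []).getD z.2 (0, 1)

/-- A member of a family of expressions. -/
def entry (u : List (List LinCode)) (z : ℕ × ℕ) : LinCode := (u.getD z.1 []).getD z.2 ([], (0, 1))

/-- Sum of the values of a function on the clocks. -/
def sum (ys : List ℕ) (F : ℕ × ℕ → RatCode) : RatCode :=
  (clocks ys).foldr (fun z r => RatCode.add (F z) r) (0, 1)

/-- Value of an expression under a valuation. -/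
def evalCode (ys : List ℕ) (v : List (List RatCode)) (C : LinCode) : RatCode :=
  RatCode.add (sum ys fun z => RatCode.mul (coef C.1 z) (coef v z)) C.2

/-- Substitution. -/
def substCode (ys : List ℕ) (u : List (List LinCode)) (C : LinCode) : LinCode :=
  (tabulate ys fun z => sum ys fun x => RatCode.mul (coef C.1 x) (coef (entry u x).1 z),
    RatCode.add (sum ys fun x => RatCode.mul (coef C.1 x) (entry u x).2) C.2)

/-- The factor by which an expression with coefficient `a` of a clock is multiplied in the
computation of its bound. -/
def boundFactor (a : RatCode) : RatCode :=
  bif RatCode.isZero a then (-1, 1) else RatCode.neg (RatCode.inv a)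

/-- The bound of an expression for a clock. -/
def boundCode (ys : List ℕ) (C : LinCode) (z : ℕ × ℕ) : LinCode :=
  (tabulate ys fun x => bif decide (x = z) then (0, 1)
      else RatCode.mul (boundFactor (coef C.1 z)) (coef C.1 x),
    RatCode.mul (boundFactor (coef C.1 z)) C.2)

/-- Difference of two expressions, with the clocks of levels above `l` replaced by `0`. -/
def subTruncateCode (ys : List ℕ) (l : ℕ) (C D : LinCode) : LinCode :=
  (tabulate ys fun x => bif decide (x.1 ≤ l)
      then RatCode.add (coef C.1 x) (RatCode.neg (coef D.1 x)) else (0, 1),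
    RatCode.add C.2 (RatCode.neg D.2))

/-- The expression consisting of a single clock. -/
def varCode (ys : List ℕ) (z : ℕ × ℕ) : LinCode :=
  (tabulate ys fun x => bif decide (x = z) then (1, 1) else (0, 1), (0, 1))

/-- The codes denote the same expression. -/
def same (ys : List ℕ) (C D : LinCode) : Bool :=
  (clocks ys).all (fun z => RatCode.isZero (RatCode.add (coef C.1 z) (RatCode.neg (coef D.1 z)))) &&
    RatCode.isZero (RatCode.add C.2 (RatCode.neg D.2))

/-- `C` is an expression over the main clocks of levels below that of `z` and the clock `z`. -/
def overMainBelowAnd (ys : List ℕ) (z : ℕ × ℕ) (C : LinCode) : Bool :=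
  (clocks ys).all fun x =>
    RatCode.isZero (coef C.1 x) || (decide (x = z) || (decide (x.1 < z.1) && decide (x.2 = 0)))

section Primrec

variable {α β : Type*} [Primcodable α] [Primcodable β] {ys : α → List ℕ} {z : α → ℕ × ℕ}
  {C D : α → LinCode}

@[fun_prop] theorem primrec_clocks (h : Primrec ys) : Primrec fun x => clocks (ys x) := by
  unfold clocks; fun_prop

@[fun_prop] theorem primrec_tabulate {F : α → ℕ × ℕ → β} (h : Primrec ys)
    (hF : Primrec fun p : α × (ℕ × ℕ) => F p.1 p.2) :
    Primrec fun x => tabulate (ys x) (F x) := by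
  unfold tabulate
  refine Primrec.fun_map (by fun_prop) (Primrec.fun_map (by fun_prop) ?_)
  exact hF.comp (g := fun p : (α × ℕ) × ℕ => (p.1.1, (p.1.2, p.2))) (by fun_prop)

@[fun_prop] theorem primrec_coef {l : α → List (List RatCode)} (h : Primrec l) (hz : Primrec z) :
    Primrec fun x => coef (l x) (z x) := by
  unfold coef; fun_prop

@[fun_prop] theorem primrec_entry {u : α → List (List LinCode)} (h : Primrec u)
    (hz : Primrec z) : Primrec fun x => entry (u x) (z x) := by
  unfold entry; fun_prop

@[fun_prop] theorem primrec_sum {F : α → ℕ × ℕ → RatCode} (h : Primrec ys)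
    (hF : Primrec fun p : α × (ℕ × ℕ) => F p.1 p.2) : Primrec fun x => sum (ys x) (F x) := by
  unfold sum
  refine Primrec.fun_foldr (by fun_prop) (by fun_prop) (RatCode.primrec_add ?_ (by fun_prop))
  exact hF.comp (g := fun p : α × (ℕ × ℕ) × RatCode => (p.1, p.2.1)) (by fun_prop)

@[fun_prop] theorem primrec_evalCode {v : α → List (List RatCode)} (h : Primrec ys)
    (hv : Primrec v) (hC : Primrec C) : Primrec fun x => evalCode (ys x) (v x) (C x) := by
  unfold evalCode; fun_prop

@[fun_prop] theorem primrec_substCode {u : α → List (List LinCode)} (h : Primrec ys)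
    (hu : Primrec u) (hC : Primrec C) : Primrec fun x => substCode (ys x) (u x) (C x) := by
  unfold substCode; fun_prop

@[fun_prop] theorem primrec_boundCode (h : Primrec ys) (hC : Primrec C) (hz : Primrec z) :
    Primrec fun x => boundCode (ys x) (C x) (z x) := by
  unfold boundCode boundFactor; fun_prop

@[fun_prop] theorem primrec_subTruncateCode {l : α → ℕ} (h : Primrec ys) (hl : Primrec l)
    (hC : Primrec C) (hD : Primrec D) :
    Primrec fun x => subTruncateCode (ys x) (l x) (C x) (D x) := by
  unfold subTruncateCode; fun_prop

@[fun_prop] theorem primrec_varCode (h : Primrec ys) (hz : Primrec z) :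
    Primrec fun x => varCode (ys x) (z x) := by
  unfold varCode; fun_prop

@[fun_prop] theorem primrec_same (h : Primrec ys) (hC : Primrec C) (hD : Primrec D) :
    Primrec fun x => same (ys x) (C x) (D x) := by
  unfold same; fun_prop

@[fun_prop] theorem primrec_overMainBelowAnd (h : Primrec ys) (hz : Primrec z)
    (hC : Primrec C) : Primrec fun x => overMainBelowAnd (ys x) (z x) (C x) := by
  unfold overMainBelowAnd; fun_prop

end Primrec

end LinCode

/-! ### Correctness of the computation with expressions -/

namespace LinCode

open LinExpr

variable {n : ℕ} {y : Fin n → ℕ}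

/-- The level of a clock and its position in it. -/
def pos (z : Clock fun i : Fin n => Fin (y i)) : ℕ × ℕ := (z.1.val, clockIndex z.2)

theorem clockIndex_injective {b : ℕ} : Function.Injective (clockIndex (b := b)) := by
  rintro (_ | i) (_ | j) h
  · rfl
  · simp [clockIndex] at h
  · simp [clockIndex] at h
  · simp only [clockIndex, Nat.add_right_cancel_iff] at h
    rw [Fin.ext h]

theorem exists_clockIndex_eq {b j : ℕ} (h : j < b + 1) :
    ∃ o : Option (Fin b), clockIndex o = j := by
  rcases j with _ | j
  · exact ⟨none, rfl⟩
  · exact ⟨some ⟨j, by omega⟩, rfl⟩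

theorem clockIndex_lt {b : ℕ} (o : Option (Fin b)) : clockIndex o < b + 1 := by
  rcases o with _ | i
  · simp [clockIndex]
  · simp [clockIndex]

theorem clockIndex_eq_zero_iff {b : ℕ} {o : Option (Fin b)} : clockIndex o = 0 ↔ o = none := by
  rcases o with _ | i <;> simp [clockIndex]

theorem pos_injective : Function.Injective (pos (y := y)) := by
  rintro ⟨i, a⟩ ⟨j, b⟩ h
  simp only [pos, Prod.mk.injEq] at h
  obtain ⟨h1, h2⟩ := h
  obtain rfl := Fin.ext h1
  rw [clockIndex_injective h2]

@[simp] theorem ofFn_getD {β : Type*} (F : Fin n → β) (i : Fin n) (d : β) :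
    (List.ofFn F).getD i.val d = F i := by
  simp [List.getD_eq_getElem?_getD]

theorem mem_clocks {p : ℕ × ℕ} : p ∈ clocks (List.ofFn y) ↔ ∃ z, pos (y := y) z = p := by
  simp only [clocks, List.mem_flatMap, List.mem_range, List.length_ofFn, List.mem_map]
  constructor
  · rintro ⟨i, hi, j, hj, rfl⟩
    rw [show i = (⟨i, hi⟩ : Fin n).val from rfl, ofFn_getD] at hj
    obtain ⟨o, ho⟩ := exists_clockIndex_eq hj
    exact ⟨⟨⟨i, hi⟩, o⟩, by simp [pos, ho]⟩
  · rintro ⟨z, rfl⟩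
    exact ⟨z.1, z.1.2, clockIndex z.2, by rw [ofFn_getD]; exact clockIndex_lt _, rfl⟩

theorem forall_mem_clocks {P : ℕ × ℕ → Prop} :
    (∀ p ∈ clocks (List.ofFn y), P p) ↔ ∀ z : Clock fun i : Fin n => Fin (y i), P (pos z) := by
  simp only [mem_clocks]
  constructor
  · exact fun h z => h _ ⟨z, rfl⟩
  · rintro h _ ⟨z, rfl⟩
    exact h z

theorem getD_map_range {β : Type*} (F : ℕ → β) {k j : ℕ} (h : j < k) (d : β) :
    ((List.range k).map F).getD j d = F j := by
  simp [List.getD_eq_getElem?_getD, h]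

theorem tabulate_getD {β : Type*} (F : ℕ × ℕ → β) (z : Clock fun i : Fin n => Fin (y i)) (d : β) :
    ((tabulate (List.ofFn y) F).getD (pos z).1 []).getD (pos z).2 d = F (pos z) := by
  unfold tabulate
  rw [getD_map_range _ (by simp [pos]), getD_map_range]
  simp only [pos, ofFn_getD]
  exact clockIndex_lt _

@[simp] theorem coef_tabulate (F : ℕ × ℕ → RatCode) (z : Clock fun i : Fin n => Fin (y i)) :
    coef (tabulate (List.ofFn y) F) (pos z) = F (pos z) := tabulate_getD F z _

theorem clockFamilyCode_getD {β : Type} (F : (Clock fun i : Fin n => Fin (y i)) → β)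
    (z : Clock fun i : Fin n => Fin (y i)) (d : β) :
    ((clockFamilyCode F).getD (pos z).1 []).getD (pos z).2 d = F z := by
  obtain ⟨i, o⟩ := z
  simp only [clockFamilyCode, pos, ofFn_getD]
  rcases o with _ | j
  · rfl
  · simp only [clockIndex, List.getD_cons_succ]
    exact ofFn_getD (fun j => F ⟨i, some j⟩) j d

@[simp] theorem coef_clockFamilyCode (F : (Clock fun i : Fin n => Fin (y i)) → RatCode)
    (z : Clock fun i : Fin n => Fin (y i)) : coef (clockFamilyCode F) (pos z) = F z :=
  clockFamilyCode_getD F z _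

@[simp] theorem entry_clockFamilyCode (F : (Clock fun i : Fin n => Fin (y i)) → LinCode)
    (z : Clock fun i : Fin n => Fin (y i)) : entry (clockFamilyCode F) (pos z) = F z :=
  clockFamilyCode_getD F z _

theorem expr_coeff (C : LinCode) (z : Clock fun i : Fin n => Fin (y i)) :
    (expr y C).1 z = (coef C.1 (pos z)).value := rfl

theorem expr_const (C : LinCode) : (expr y C).2 = C.2.value := rfl

@[simp] theorem expr_linCode (C : LinExpr (Clock fun i : Fin n => Fin (y i))) :
    expr y (linCode C) = C := by
  ext z
  · rw [expr_coeff]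
    simp [linCode]
  · simp [expr_const, linCode]

theorem value_sum_clocks (F : ℕ × ℕ → RatCode) :
    (sum (List.ofFn y) F).value = ∑ z : Clock fun i : Fin n => Fin (y i), (F (pos z)).value := by
  have h1 : ∀ l : List (ℕ × ℕ), (l.foldr (fun z r => RatCode.add (F z) r) (0, 1)).value =
      (l.map fun z => (F z).value).sum := by
    intro l
    induction l with
    | nil => simp [RatCode.value]
    | cons a l ih => simp [RatCode.value_add, ih]
  have h2 : ∀ k : ℕ, ∀ G : ℕ → ℚ, ((List.range k).map G).sum = ∑ i ∈ Finset.range k, G i := by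
    intro k G
    rw [Finset.sum_eq_multiset_sum]
    simp [Multiset.range]
  rw [sum, h1, clocks, List.map_flatMap, List.flatMap_def, List.sum_flatten]
  simp only [List.map_map, h2, Function.comp_def, List.length_ofFn]
  rw [Fintype.sum_sigma, Finset.sum_range]
  refine Finset.sum_congr rfl fun i _ => ?_
  rw [ofFn_getD, Fintype.sum_option, Finset.sum_range, Fin.sum_univ_succ]
  rfl

theorem value_evalCode (v : List (List RatCode)) (C : LinCode) :
    ((evalCode (List.ofFn y) v C).value : ℝ) =
      eval (fun z : Clock fun i : Fin n => Fin (y i) => ((coef v (pos z)).value : ℝ))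
        (expr y C) := by
  simp only [evalCode, RatCode.value_add, value_sum_clocks, RatCode.value_mul, eval, expr_coeff,
    expr_const]
  push_cast
  rfl

theorem expr_substCode (u : List (List LinCode)) (C : LinCode) :
    expr y (substCode (List.ofFn y) u C) =
      (expr y C).subst fun z => expr y (entry u (pos z)) := by
  ext z
  · rw [expr_coeff, subst_coeff]
    simp only [substCode, coef_tabulate, value_sum_clocks, RatCode.value_mul, expr_coeff]
  · rw [expr_const, subst_const]
    simp only [substCode, RatCode.value_add, value_sum_clocks, RatCode.value_mul, expr_coeff,
      expr_const]

theorem value_boundFactor (a : RatCode) :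
    (boundFactor a).value = if a.value = 0 then -1 else -a.value⁻¹ := by
  have h1 : RatCode.value (-1, 1) = -1 := by simp [RatCode.value]
  by_cases h : a.value = 0
  · simp [boundFactor, (RatCode.isZero_iff a).2 h, h, h1]
  · have : RatCode.isZero a = false := by
      rw [← Bool.not_eq_true, RatCode.isZero_iff]
      exact h
    simp [boundFactor, this, h, RatCode.value_neg, RatCode.value_inv]

theorem expr_boundCode (C : LinCode) (z : Clock fun i : Fin n => Fin (y i)) :
    expr y (boundCode (List.ofFn y) C (pos z)) = (expr y C).bound z := by
  ext x
  · rw [expr_coeff]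
    simp only [boundCode, coef_tabulate]
    by_cases hx : x = z
    · subst hx
      simp [bound_coeff_self, RatCode.value]
    · have : pos x ≠ pos z := fun h => hx (pos_injective h)
      rw [bound_coeff_of_ne _ hx]
      simp only [this, decide_false, cond_false, RatCode.value_mul, value_boundFactor, expr_coeff]
      by_cases h : (coef C.1 (pos z)).value = 0 <;> simp [h]
  · rw [expr_const, bound_const]
    simp only [boundCode, RatCode.value_mul, value_boundFactor, expr_coeff, expr_const]
    by_cases h : (coef C.1 (pos z)).value = 0 <;> simp [h]

theorem expr_subTruncateCode (l : Fin n) (C D : LinCode) :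
    expr y (subTruncateCode (List.ofFn y) l.val C D) = (expr y C - expr y D).truncate l := by
  ext x
  · rw [expr_coeff]
    simp only [subTruncateCode, coef_tabulate, truncate, Prod.fst_sub, Pi.sub_apply, expr_coeff]
    by_cases h : x.1 ≤ l
    · have h' : (pos x).1 ≤ l.val := h
      simp [h, h', RatCode.value_add, RatCode.value_neg, sub_eq_add_neg]
    · have h' : ¬ (pos x).1 ≤ l.val := h
      simp [h, h', RatCode.value]
  · rw [expr_const]
    simp [subTruncateCode, truncate, RatCode.value_add, RatCode.value_neg, sub_eq_add_neg,
      expr_const]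

theorem expr_varCode (z : Clock fun i : Fin n => Fin (y i)) :
    expr y (varCode (List.ofFn y) (pos z)) = var z := by
  ext x
  · rw [expr_coeff]
    simp only [varCode, coef_tabulate]
    by_cases hx : x = z
    · subst hx; simp [RatCode.value]
    · have : pos x ≠ pos z := fun h => hx (pos_injective h)
      simp [this, var_coeff_of_ne hx, RatCode.value]
  · simp [expr_const, varCode, var, RatCode.value]

theorem expr_nil : expr y ([], (0, 1)) = 0 := by
  ext x
  · simp [expr_coeff, coef, RatCode.value]
  · simp [expr_const, RatCode.value]

theorem same_iff (C D : LinCode) : same (List.ofFn y) C D = true ↔ expr y C = expr y D := by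
  simp only [same, Bool.and_eq_true, List.all_eq_true, forall_mem_clocks, RatCode.isZero_iff,
    RatCode.value_add, RatCode.value_neg, ← sub_eq_add_neg, sub_eq_zero]
  rw [Prod.ext_iff, funext_iff]
  rfl

theorem overMainBelowAnd_iff (k : Fin n) (o : Option (Fin (y k))) (C : LinCode) :
    overMainBelowAnd (List.ofFn y) (pos (⟨k, o⟩ : Clock fun i : Fin n => Fin (y i))) C = true ↔
      (expr y C).OverMainBelowAnd k o := by
  simp only [overMainBelowAnd, List.all_eq_true, forall_mem_clocks, Bool.or_eq_true,
    Bool.and_eq_true, RatCode.isZero_iff, decide_eq_true_eq]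
  refine forall_congr' fun x => ?_
  rw [expr_coeff, pos_injective.eq_iff, ne_eq, ← or_iff_not_imp_left]
  simp only [pos, clockIndex_eq_zero_iff, Fin.lt_def]

end LinCode

/-! ### Computing the saturated sets -/

namespace ITACode

/-- The numbers of auxiliary clocks of the levels. -/
def auxs (c : ITACode) : List ℕ := c.2.2.1

/-- The transitions. -/
def trans (c : ITACode) : List TransitionCode := c.2.2.2.2.2.2.2

/-- The level of a state. -/
def level (c : ITACode) (q : ℕ) : ℕ := c.2.2.2.2.2.1.getD q 0

/-- The active clock of a state. -/
def actClock (c : ITACode) (q : ℕ) : ℕ × ℕ := (level c q, c.2.2.2.2.2.2.1.getD q 0)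

/-- The state is final. -/
def isFinal (c : ITACode) (q : ℕ) : Bool := c.2.2.2.2.1.getD q false

/-- The expressions obtained by one application of a saturation rule to expressions of `S`, where
`(k, C)` in `S` stands for an element `C` of `E_k`. The rule for transitions to higher levels is
also applied to equal expressions, which only adds `0`. -/
def saturateStep (c : ITACode) (S : List (ℕ × LinCode)) : List (ℕ × LinCode) :=
  ((LinCode.clocks (auxs c)).map fun z => (z.1, LinCode.varCode (auxs c) z)) ++
  (((List.range (auxs c).length).map fun k => (k, (([], (0, 1)) : LinCode))) ++
  (((trans c).flatMap fun t => t.2.1.flatMap fun g =>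
    ((LinCode.clocks (auxs c)).filter fun z =>
      decide (z.1 = level c t.1) && LinCode.overMainBelowAnd (auxs c) z g.1).map fun z =>
        (z.1, LinCode.boundCode (auxs c) g.1 z)) ++
  (((trans c).flatMap fun t =>
    (S.filter fun p => decide (p.1 ≤ level c t.1) && decide (p.1 ≤ level c t.2.2.2.2)).map fun p =>
      (p.1, LinCode.substCode (auxs c) t.2.2.2.1 p.2)) ++
  ((trans c).flatMap fun t =>
    (S.filter fun p => decide (level c t.1 < p.1) && decide (p.1 ≤ level c t.2.2.2.2)).flatMap
      fun p => (S.filter fun p' => decide (p'.1 = p.1)).map fun p' =>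
        (level c t.1, LinCode.boundCode (auxs c) (LinCode.subTruncateCode (auxs c) (level c t.1)
          (LinCode.substCode (auxs c) t.2.2.2.1 p.2) (LinCode.substCode (auxs c) t.2.2.2.1 p'.2))
          (level c t.1, 0))))))

/-- The expressions obtained in at most `N` rounds of saturation. -/
def saturate (c : ITACode) (N : ℕ) : List (ℕ × LinCode) :=
  (fun S => S ++ saturateStep c S)^[N] []

/-- Saturation adds no new expressions to `S`. -/
def isClosed (c : ITACode) (S : List (ℕ × LinCode)) : Bool :=
  (saturateStep c S).all fun p => S.any fun q =>
    decide (q.1 = p.1) && LinCode.same (auxs c) q.2 p.2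

section Primrec

variable {α : Type*} [Primcodable α] {c : α → ITACode} {q : α → ℕ} {S : α → List (ℕ × LinCode)}

@[fun_prop] theorem primrec_auxs (h : Primrec c) : Primrec fun x => auxs (c x) := by
  unfold auxs; fun_prop

@[fun_prop] theorem primrec_trans (h : Primrec c) : Primrec fun x => trans (c x) := by
  unfold trans; fun_prop

@[fun_prop] theorem primrec_level (h : Primrec c) (hq : Primrec q) :
    Primrec fun x => level (c x) (q x) := by
  unfold level; fun_prop

@[fun_prop] theorem primrec_actClock (h : Primrec c) (hq : Primrec q) :
    Primrec fun x => actClock (c x) (q x) := by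
  unfold actClock; fun_prop

@[fun_prop] theorem primrec_isFinal (h : Primrec c) (hq : Primrec q) :
    Primrec fun x => isFinal (c x) (q x) := by
  unfold isFinal; fun_prop

@[fun_prop] theorem primrec_saturateStep (h : Primrec c) (hS : Primrec S) :
    Primrec fun x => saturateStep (c x) (S x) := by
  unfold saturateStep; fun_prop

@[fun_prop] theorem primrec_saturate {N : α → ℕ} (h : Primrec c) (hN : Primrec N) :
    Primrec fun x => saturate (c x) (N x) := by
  unfold saturate
  exact Primrec.fun_iterate hN (by fun_prop) (by fun_prop)

@[fun_prop] theorem primrec_isClosed (h : Primrec c) (hS : Primrec S) :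
    Primrec fun x => isClosed (c x) (S x) := by
  unfold isClosed; fun_prop

end Primrec

end ITACode

/-! ### Correctness and termination of saturation -/

namespace ITA

open LinExpr LinCode ITACode

variable {s m n : ℕ} {y : Fin n → ℕ} (A : ITA (Fin s) (Fin m) fun i : Fin n => Fin (y i))

@[simp] theorem auxs_code : auxs A.code = List.ofFn y := rfl

@[simp] theorem trans_code : ITACode.trans A.code = A.trans.map Transition.code := rfl

@[simp] theorem level_code (q : Fin m) : ITACode.level A.code q.val = (A.level q).val :=
  ofFn_getD (fun q => (A.level q).val) q 0

@[simp] theorem actClock_code (q : Fin m) : ITACode.actClock A.code q.val = pos (A.actClock q) := by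
  simp only [ITACode.actClock, level_code]
  exact congrArg _ (ofFn_getD (fun q => clockIndex (A.act q)) q 0)

theorem isFinal_code (q : Fin m) : isFinal A.code q.val = true ↔ q ∈ A.final := by
  classical
  have : isFinal A.code q.val = decide (q ∈ A.final) := by
    refine (ofFn_getD (fun q => _) q false).trans ?_
    congr
  rw [this, decide_eq_true_eq]

theorem entry_update_code (e : Transition (Fin s) (Fin m) (Clock fun i : Fin n => Fin (y i))) :
    (fun z : Clock fun i : Fin n => Fin (y i) => expr y (entry e.code.2.2.2.1 (pos z))) =
      e.update := by
  funext z
  simp [Transition.code]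

variable {A} {S : List (ℕ × LinCode)}

/-- Saturation of codes only yields elements of the saturated sets. -/
theorem sound_saturateStep (hS : ∀ p ∈ S, ∃ k : Fin n, p.1 = k.val ∧ A.Saturated k (expr y p.2))
    {p : ℕ × LinCode} (hp : p ∈ saturateStep A.code S) :
    ∃ k : Fin n, p.1 = k.val ∧ A.Saturated k (expr y p.2) := by
  simp only [saturateStep, List.mem_append, List.mem_map, List.mem_flatMap, List.mem_filter,
    auxs_code, trans_code, Bool.and_eq_true, decide_eq_true_eq] at hp
  rcases hp with ⟨z, hz, rfl⟩ | ⟨k, hk, rfl⟩ | ⟨_, ⟨e, he, rfl⟩, _, hg, z, ⟨hz, hl, ho⟩, rfl⟩ |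
    ⟨_, ⟨e, he, rfl⟩, p, ⟨hp, h1, h2⟩, rfl⟩ |
    ⟨_, ⟨e, he, rfl⟩, p, ⟨hp, h1, h2⟩, p', ⟨hp', h3⟩, rfl⟩
  · obtain ⟨z, rfl⟩ := mem_clocks.1 hz
    exact ⟨z.1, rfl, by rw [expr_varCode]; exact Saturated.clock (A := A) z.1 z.2⟩
  · rw [List.mem_range, List.length_ofFn] at hk
    exact ⟨⟨k, hk⟩, rfl, by rw [expr_nil]; exact Saturated.zero _⟩
  · obtain ⟨⟨k, o⟩, rfl⟩ := mem_clocks.1 hz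
    simp only [Transition.code, List.mem_map] at hg
    obtain ⟨g, hg, rfl⟩ := hg
    rw [show e.code.1 = e.src.val from rfl, level_code] at hl
    obtain rfl : k = A.level e.src := Fin.ext hl
    rw [overMainBelowAnd_iff, expr_linCode] at ho
    refine ⟨_, rfl, ?_⟩
    rw [expr_boundCode, expr_linCode]
    exact Saturated.guard o he hg ho
  · obtain ⟨k, hk, hC⟩ := hS p hp
    rw [show e.code.1 = e.src.val from rfl, level_code, hk] at h1
    rw [show e.code.2.2.2.2 = e.tgt.val from rfl, level_code, hk] at h2
    refine ⟨k, hk, ?_⟩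
    rw [expr_substCode, entry_update_code]
    exact Saturated.update he h1 h2 hC
  · obtain ⟨k, hk, hC⟩ := hS p hp
    obtain ⟨k', hk', hC'⟩ := hS p' hp'
    obtain rfl : k' = k := Fin.ext (by omega)
    rw [show e.code.1 = e.src.val from rfl, level_code, hk] at h1
    rw [show e.code.2.2.2.2 = e.tgt.val from rfl, level_code, hk] at h2
    refine ⟨A.level e.src, level_code A e.src, ?_⟩
    rw [show e.code.1 = e.src.val from rfl, level_code]
    have hpos : ((A.level e.src).val, 0) =
      pos (⟨A.level e.src, none⟩ : Clock fun i : Fin n => Fin (y i)) := rfl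
    rw [hpos, expr_boundCode, expr_subTruncateCode, expr_substCode, expr_substCode,
      entry_update_code]
    by_cases hne : expr y p.2 = expr y p'.2
    · have h0 : (0 : LinExpr (Clock fun i : Fin n => Fin (y i))).truncate (A.level e.src) = 0 := by
        ext z <;> simp [truncate]
      rw [hne, sub_self, h0, bound_zero]
      exact Saturated.zero _
    · exact Saturated.cross he h1 h2 hC hC' hne

/-- A list closed under saturation contains codes of all elements of the saturated sets. -/
theorem complete_of_isClosed (hS : isClosed A.code S = true) {k : Fin n}
    {C : LinExpr (Clock fun i : Fin n => Fin (y i))} (hC : A.Saturated k C) :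
    ∃ p ∈ S, p.1 = k.val ∧ expr y p.2 = C := by
  have hcl : ∀ p ∈ saturateStep A.code S, ∃ q ∈ S, q.1 = p.1 ∧ expr y q.2 = expr y p.2 := by
    simpa only [isClosed, List.all_eq_true, List.any_eq_true, Bool.and_eq_true, decide_eq_true_eq,
      auxs_code, same_iff] using hS
  simp only [saturateStep, List.mem_append, List.mem_map, List.mem_flatMap, List.mem_filter,
    auxs_code, trans_code, Bool.and_eq_true, decide_eq_true_eq] at hcl
  induction hC with
  | clock k o =>
    obtain ⟨q, hq, h1, h2⟩ := hcl _ (Or.inl ⟨pos ⟨k, o⟩, mem_clocks.2 ⟨_, rfl⟩, rfl⟩)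
    exact ⟨q, hq, h1, by rw [h2, expr_varCode]⟩
  | zero k =>
    obtain ⟨q, hq, h1, h2⟩ := hcl _ (Or.inr (Or.inl ⟨k.val, by simp, rfl⟩))
    exact ⟨q, hq, h1, by rw [h2, expr_nil]⟩
  | @guard e c o he hc hC =>
    obtain ⟨q, hq, h1, h2⟩ := hcl _ (Or.inr (Or.inr (Or.inl ⟨_, ⟨e, he, rfl⟩,
      (linCode c.1, c.2.code), List.mem_map.2 ⟨c, hc, rfl⟩, pos ⟨A.level e.src, o⟩,
      ⟨mem_clocks.2 ⟨_, rfl⟩, (level_code A e.src).symm,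
        (overMainBelowAnd_iff _ _ _).2 (by rwa [expr_linCode])⟩, rfl⟩)))
    exact ⟨q, hq, h1, by rw [h2, expr_boundCode, expr_linCode]⟩
  | @update k e C he hk hk' _ ih =>
    obtain ⟨p, hp, hpk, rfl⟩ := ih
    obtain ⟨q, hq, h1, h2⟩ := hcl _ (Or.inr (Or.inr (Or.inr (Or.inl ⟨_, ⟨e, he, rfl⟩, p,
      ⟨hp, by rw [hpk]; exact (Fin.le_def.1 hk).trans_eq (level_code A e.src).symm,
        by rw [hpk]; exact (Fin.le_def.1 hk').trans_eq (level_code A e.tgt).symm⟩, rfl⟩))))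
    exact ⟨q, hq, h1.trans hpk, by rw [h2, expr_substCode, entry_update_code]⟩
  | @cross k e C C' he hk hk' _ _ _ ih ih' =>
    obtain ⟨p, hp, hpk, rfl⟩ := ih
    obtain ⟨p', hp', hpk', rfl⟩ := ih'
    obtain ⟨q, hq, h1, h2⟩ := hcl _ (Or.inr (Or.inr (Or.inr (Or.inr ⟨_, ⟨e, he, rfl⟩, p,
      ⟨hp, by rw [hpk]; exact (level_code A e.src).trans_lt hk,
        by rw [hpk]; exact (Fin.le_def.1 hk').trans_eq (level_code A e.tgt).symm⟩, p',
      ⟨hp', hpk'.trans hpk.symm⟩, rfl⟩))))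
    have hl : ITACode.level A.code e.code.1 = (A.level e.src).val := level_code A e.src
    have hpos : ((A.level e.src).val, 0) =
      pos (⟨A.level e.src, none⟩ : Clock fun i : Fin n => Fin (y i)) := rfl
    refine ⟨q, hq, h1.trans hl, ?_⟩
    rw [h2, hl, hpos, expr_boundCode, expr_subTruncateCode, expr_substCode, expr_substCode,
      entry_update_code]

theorem sound_saturate (N : ℕ) : ∀ p ∈ saturate A.code N,
    ∃ k : Fin n, p.1 = k.val ∧ A.Saturated k (expr y p.2) := by
  induction N with
  | zero => simp [saturate]
  | succ N ih =>
    intro p hp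
    rw [saturate, Function.iterate_succ_apply', List.mem_append] at hp
    rcases hp with hp | hp
    · exact ih p hp
    · exact sound_saturateStep ih hp

theorem exists_succ_subset_of_finite {α : Type*} {T : ℕ → Set α} (hT : Monotone T) {F : Set α}
    (hF : F.Finite) (hTF : ∀ N, T N ⊆ F) : ∃ N, T (N + 1) ⊆ T N := by
  by_contra! h
  have : ∀ N, N ≤ (T N).ncard := by
    intro N
    induction N with
    | zero => exact Nat.zero_le _
    | succ N ih =>
      have := Set.ncard_lt_ncard ((hT (Nat.le_add_right N 1)).ssubset_of_not_subset (h N))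
        (hF.subset (hTF _))
      omega
  have h1 := this (F.ncard + 1)
  have h2 := Set.ncard_le_ncard (hTF (F.ncard + 1)) hF
  omega

variable (A) in
/-- As the saturated sets are finite, their computation terminates. -/
theorem exists_isClosed_saturate : ∃ N, isClosed A.code (saturate A.code N) = true := by
  let T : ℕ → Set (Fin n × LinExpr (Clock fun i : Fin n => Fin (y i))) := fun N =>
    {x | ∃ p ∈ saturate A.code N, p.1 = x.1.val ∧ expr y p.2 = x.2}
  have hsucc : ∀ N, saturate A.code (N + 1) =
      saturate A.code N ++ saturateStep A.code (saturate A.code N) := fun N => by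
    rw [saturate, Function.iterate_succ_apply']
    rfl
  have hmono : Monotone T := monotone_nat_of_le_succ fun N => by
    rintro x ⟨p, hp, h⟩
    exact ⟨p, by rw [hsucc]; exact List.mem_append_left _ hp, h⟩
  have hfin : (⋃ k : Fin n, Prod.mk k '' A.E k).Finite :=
    Set.finite_iUnion fun k => (finite_E k).image _
  obtain ⟨N, hN⟩ := exists_succ_subset_of_finite hmono hfin (by
    rintro N ⟨k, C⟩ ⟨p, hp, h1, h2⟩
    obtain ⟨k', hk', hC⟩ := sound_saturate N p hp
    obtain rfl : k' = k := Fin.ext (hk'.symm.trans h1)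
    have h2 : expr y p.2 = C := h2
    exact Set.mem_iUnion.2 ⟨k', C, h2 ▸ hC, rfl⟩)
  refine ⟨N, ?_⟩
  simp only [isClosed, List.all_eq_true, List.any_eq_true, Bool.and_eq_true, decide_eq_true_eq,
      auxs_code, same_iff]
  intro p hp
  obtain ⟨k, hk, -⟩ := sound_saturateStep (sound_saturate N) hp
  obtain ⟨q, hq, h1, h2⟩ := hN (show (k, expr y p.2) ∈ T (N + 1) from
    ⟨p, by rw [hsucc]; exact List.mem_append_right _ hp, hk, rfl⟩)
  exact ⟨q, hq, h1.trans hk.symm, h2⟩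

end ITA

/-! ### Computing with rational configurations

A configuration is coded by its state and the family of the clock values. -/

/-- A configuration with rational clock values. -/
abbrev ConfigCode := ℕ × List (List RatCode)

/-- Satisfaction of the comparison with `0` that has the code `o`. -/
def Cmp.holdsCode (o : ℕ) (r : RatCode) : Bool :=
  bif decide (o = 0) then !RatCode.le r (0, 1)
  else bif decide (o = 1) then RatCode.le (0, 1) r
  else bif decide (o = 2) then RatCode.le r (0, 1) && RatCode.le (0, 1) r
  else bif decide (o = 3) then RatCode.le r (0, 1)
  else !RatCode.le (0, 1) r

namespace ITACode

open LinCode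

/-- The elements of level `k` in a list of expressions with their levels. -/
def atLevel (S : List (ℕ × LinCode)) (k : ℕ) : List LinCode :=
  (S.filter fun p => decide (p.1 = k)).map Prod.snd

/-- Comparison of the values of two expressions. -/
def leAt (c : ITACode) (s : ConfigCode) (f g : LinCode) : Bool :=
  RatCode.le (evalCode (auxs c) s.2 f) (evalCode (auxs c) s.2 g)

/-- The class of a configuration, for the saturated sets listed in `S`. -/
def classCode (c : ITACode) (S : List (ℕ × LinCode)) (s : ConfigCode) : ClassCode :=
  (s.1, (List.range (level c s.1 + 1)).map fun k => (atLevel S k).flatMap fun f =>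
    ((atLevel S k).filter fun g => leAt c s f g).map fun g => (f, g))

/-- The state exists, and the clocks above its level are zero. -/
def isValid (c : ITACode) (s : ConfigCode) : Bool :=
  decide (s.1 < c.2.1) && (clocks (auxs c)).all fun z =>
    decide (z.1 ≤ level c s.1) || RatCode.isZero (coef s.2 z)

/-- A transition is enabled. -/
def isEnabled (c : ITACode) (t : TransitionCode) (s : ConfigCode) : Bool :=
  decide (s.1 = t.1) && t.2.1.all fun g => Cmp.holdsCode g.2 (evalCode (auxs c) s.2 g.1)

/-- The effect of a transition. -/
def fire (c : ITACode) (t : TransitionCode) (s : ConfigCode) : ConfigCode :=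
  (t.2.2.2.2, tabulate (auxs c) fun z => evalCode (auxs c) s.2 (entry t.2.2.2.1 z))

/-- Comparison in the time successor of the class of `s`, at the level of the state. -/
def postLeAt (c : ITACode) (S : List LinCode) (s : ConfigCode) (a f g : LinCode) : Bool :=
  bif S.any fun h => !same (auxs c) h a && (leAt c s h a && leAt c s a h) then
    leAt c s f g && !(same (auxs c) f a && (!same (auxs c) g a && leAt c s g a))
  else
    leAt c s f g || (same (auxs c) g a && (!leAt c s f a &&
      S.all fun h => leAt c s h a || leAt c s f h))

/-- The class of `s'` is the time successor of that of `s`. -/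
def isTimeSucc (c : ITACode) (S : List (ℕ × LinCode)) (s s' : ConfigCode) : Bool :=
  decide (s'.1 = s.1) &&
  (((List.range (level c s.1)).all fun k => (atLevel S k).all fun f => (atLevel S k).all fun g =>
    decide (leAt c s' f g = leAt c s f g)) &&
  ((atLevel S (level c s.1)).all fun f => (atLevel S (level c s.1)).all fun g =>
    decide (leAt c s' f g = postLeAt c (atLevel S (level c s.1)) s
      (varCode (auxs c) (actClock c s.1)) f g)))

set_option synthInstance.maxSize 2000 in
/-- The configurations have the same class. -/
def sameClass (c : ITACode) (S : List (ℕ × LinCode)) (s s' : ConfigCode) : Bool :=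
  decide (classCode c S s = classCode c S s')

/-- The initial configuration. -/
def initConfig (c : ITACode) : ConfigCode := (c.2.2.2.1, [])

/-- The list `L` contains representatives of all classes accessible from its elements. -/
def isComplete (c : ITACode) (S : List (ℕ × LinCode)) (L : List ConfigCode) : Bool :=
  L.all fun s => isValid c s && ((L.any fun s' => isTimeSucc c S s s') &&
    (trans c).all fun t => !isEnabled c t s || L.any fun s' => sameClass c S (fire c t s) s')

/-- The edges between the classes of the configurations in `L`. -/
def edgeList (c : ITACode) (S : List (ℕ × LinCode)) (L : List ConfigCode) :
    List (ClassCode × Option ℕ × ClassCode) :=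
  L.flatMap fun s => L.flatMap fun s' =>
    (bif isTimeSucc c S s s' then [(classCode c S s, none, classCode c S s')] else []) ++
    ((List.range (trans c).length).filter fun e =>
      isEnabled c ((trans c).getD e (0, [], none, [], 0)) s &&
        sameClass c S (fire c ((trans c).getD e (0, [], none, [], 0)) s) s').map fun e =>
          (classCode c S s, some e, classCode c S s')

/-- The automaton on the classes of the configurations in `L`. -/
def output (c : ITACode) (S : List (ℕ × LinCode)) (L : List ConfigCode) : ClassAutomatonCode :=
  (L.map fun s => classCode c S s, classCode c S (initConfig c),
    (L.filter fun s => isFinal c s.1).map fun s => classCode c S s, edgeList c S L)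

/-- The automaton computed from a number `N` of rounds of saturation and a list `L` of
configurations, if these suffice. -/
def candidate (c : ITACode) (p : ℕ × List ConfigCode) : Option ClassAutomatonCode :=
  bif isClosed c (saturate c p.1) && isComplete c (saturate c p.1) (initConfig c :: p.2) then
    some (output c (saturate c p.1) (initConfig c :: p.2)) else none

section Primrec

variable {α : Type*} [Primcodable α] {c : α → ITACode} {S : α → List (ℕ × LinCode)}
  {s s' : α → ConfigCode} {f g : α → LinCode} {t : α → TransitionCode} {L : α → List ConfigCode}

@[fun_prop] theorem primrec_atLevel {k : α → ℕ} (hS : Primrec S) (hk : Primrec k) :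
    Primrec fun x => atLevel (S x) (k x) := by
  unfold atLevel; fun_prop

@[fun_prop] theorem primrec_leAt (h : Primrec c) (hs : Primrec s) (hf : Primrec f)
    (hg : Primrec g) : Primrec fun x => leAt (c x) (s x) (f x) (g x) := by
  unfold leAt; fun_prop

@[fun_prop] theorem primrec_classCode (h : Primrec c) (hS : Primrec S) (hs : Primrec s) :
    Primrec fun x => classCode (c x) (S x) (s x) := by
  unfold classCode; fun_prop

@[fun_prop] theorem primrec_isValid (h : Primrec c) (hs : Primrec s) :
    Primrec fun x => isValid (c x) (s x) := by
  unfold isValid; fun_prop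

@[fun_prop] theorem primrec_holdsCode {o : α → ℕ} {r : α → RatCode} (ho : Primrec o)
    (hr : Primrec r) : Primrec fun x => Cmp.holdsCode (o x) (r x) := by
  unfold Cmp.holdsCode; fun_prop

@[fun_prop] theorem primrec_isEnabled (h : Primrec c) (ht : Primrec t) (hs : Primrec s) :
    Primrec fun x => isEnabled (c x) (t x) (s x) := by
  unfold isEnabled; fun_prop

@[fun_prop] theorem primrec_fire (h : Primrec c) (ht : Primrec t) (hs : Primrec s) :
    Primrec fun x => fire (c x) (t x) (s x) := by
  unfold fire; fun_prop

@[fun_prop] theorem primrec_postLeAt {T : α → List LinCode} {a : α → LinCode} (h : Primrec c)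
    (hT : Primrec T) (hs : Primrec s) (ha : Primrec a) (hf : Primrec f) (hg : Primrec g) :
    Primrec fun x => postLeAt (c x) (T x) (s x) (a x) (f x) (g x) := by
  unfold postLeAt; fun_prop

@[fun_prop] theorem primrec_isTimeSucc (h : Primrec c) (hS : Primrec S) (hs : Primrec s)
    (hs' : Primrec s') : Primrec fun x => isTimeSucc (c x) (S x) (s x) (s' x) := by
  unfold isTimeSucc; fun_prop

@[fun_prop] theorem primrec_sameClass (h : Primrec c) (hS : Primrec S) (hs : Primrec s)
    (hs' : Primrec s') : Primrec fun x => sameClass (c x) (S x) (s x) (s' x) := by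
  unfold sameClass; fun_prop

@[fun_prop] theorem primrec_initConfig (h : Primrec c) : Primrec fun x => initConfig (c x) := by
  unfold initConfig; fun_prop

@[fun_prop] theorem primrec_isComplete (h : Primrec c) (hS : Primrec S) (hL : Primrec L) :
    Primrec fun x => isComplete (c x) (S x) (L x) := by
  unfold isComplete; fun_prop

@[fun_prop] theorem primrec_edgeList (h : Primrec c) (hS : Primrec S) (hL : Primrec L) :
    Primrec fun x => edgeList (c x) (S x) (L x) := by
  unfold edgeList; fun_prop

@[fun_prop] theorem primrec_output (h : Primrec c) (hS : Primrec S) (hL : Primrec L) :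
    Primrec fun x => output (c x) (S x) (L x) := by
  unfold output; fun_prop

@[fun_prop] theorem primrec_candidate {p : α → ℕ × List ConfigCode} (h : Primrec c)
    (hp : Primrec p) : Primrec fun x => candidate (c x) (p x) := by
  unfold candidate; fun_prop

end Primrec

/-- The construction of the class automaton: search for a suitable pair of a number of rounds of
saturation and a list of configurations. -/
def build (c : ITACode) : Part ClassAutomatonCode :=
  Nat.rfindOpt fun k =>
    (Encodable.decode k : Option (ℕ × List ConfigCode)).bind fun p => candidate c p

theorem partrec_build : Partrec build := by
  refine Partrec.rfindOpt (Primrec.to_comp ?_)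
  refine Primrec.option_bind (Primrec.decode.comp Primrec.snd) ?_
  exact primrec_candidate (Primrec.fst.comp Primrec.fst) Primrec.snd

theorem mem_build_of_candidate {c : ITACode} {p : ℕ × List ConfigCode}
    (h : (candidate c p).isSome) : ∃ q B, candidate c q = some B ∧ B ∈ build c := by
  obtain ⟨B, hB⟩ := Option.isSome_iff_exists.1 h
  have hdom : (build c).Dom := Nat.rfindOpt_dom.2 ⟨Encodable.encode p, B, by
    rw [Encodable.encodek]; exact hB⟩
  obtain ⟨B', hB'⟩ := Part.dom_iff_mem.1 hdom
  obtain ⟨k, hk⟩ := Nat.rfindOpt_spec hB'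
  obtain ⟨q, -, hq⟩ := Option.bind_eq_some_iff.1 hk
  exact ⟨q, B', hq, hB'⟩

end ITACode

/-! ### Correctness of the computation with configurations -/

namespace ITA

open LinExpr LinCode ITACode

variable {s m n : ℕ} {y : Fin n → ℕ} (A : ITA (Fin s) (Fin m) fun i : Fin n => Fin (y i))

/-- The code `x` denotes the configuration `σ`. -/
def Denotes (x : ConfigCode) (σ : A.Config) : Prop :=
  x.1 = σ.1.val ∧ ∀ z, σ.2 z = ((coef x.2 (pos z)).value : ℝ)

/-- The list `S` contains exactly codes of the elements of the saturated sets. -/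
def Lists (S : List (ℕ × LinCode)) : Prop :=
  (∀ p ∈ S, ∃ k : Fin n, p.1 = k.val ∧ A.Saturated k (expr y p.2)) ∧
    ∀ k C, A.Saturated k C → ∃ p ∈ S, p.1 = k.val ∧ expr y p.2 = C

variable {A} {S : List (ℕ × LinCode)} {x x' : ConfigCode} {σ σ' : A.Config}

theorem Lists.saturated (hS : A.Lists S) {k : Fin n} {f : LinCode} (hf : f ∈ atLevel S k.val) :
    A.Saturated k (expr y f) := by
  simp only [atLevel, List.mem_map, List.mem_filter, decide_eq_true_eq] at hf
  obtain ⟨p, ⟨hp, hk⟩, rfl⟩ := hf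
  obtain ⟨k', hk', h⟩ := hS.1 p hp
  obtain rfl : k' = k := Fin.ext (hk'.symm.trans hk)
  exact h

theorem Lists.exists_code (hS : A.Lists S) {k : Fin n}
    {C : LinExpr (Clock fun i : Fin n => Fin (y i))} (hC : A.Saturated k C) :
    ∃ f ∈ atLevel S k.val, expr y f = C := by
  obtain ⟨p, hp, hk, rfl⟩ := hS.2 k C hC
  exact ⟨p.2, List.mem_map.2 ⟨p, List.mem_filter.2 ⟨hp, decide_eq_true hk⟩, rfl⟩, rfl⟩

theorem Lists.exists_iff (hS : A.Lists S) {k : Fin n}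
    {P : LinExpr (Clock fun i : Fin n => Fin (y i)) → Prop} :
    (∃ f ∈ atLevel S k.val, P (expr y f)) ↔ ∃ f : A.E k, P f.1 := by
  constructor
  · rintro ⟨f, hf, h⟩
    exact ⟨⟨_, hS.saturated hf⟩, h⟩
  · rintro ⟨⟨C, hC⟩, h⟩
    obtain ⟨f, hf, rfl⟩ := hS.exists_code hC
    exact ⟨f, hf, h⟩

theorem Lists.forall_iff (hS : A.Lists S) {k : Fin n}
    {P : LinExpr (Clock fun i : Fin n => Fin (y i)) → Prop} :
    (∀ f ∈ atLevel S k.val, P (expr y f)) ↔ ∀ f : A.E k, P f.1 := by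
  constructor
  · rintro h ⟨C, hC⟩
    obtain ⟨f, hf, rfl⟩ := hS.exists_code hC
    exact h f hf
  · exact fun h f hf => h ⟨_, hS.saturated hf⟩

theorem Denotes.value_evalCode (h : A.Denotes x σ) (f : LinCode) :
    ((evalCode (List.ofFn y) x.2 f).value : ℝ) = eval σ.2 (expr y f) := by
  rw [LinCode.value_evalCode]
  congr 1
  funext z
  exact (h.2 z).symm

theorem Denotes.leAt_iff (h : A.Denotes x σ) (f g : LinCode) :
    leAt A.code x f g = true ↔ eval σ.2 (expr y f) ≤ eval σ.2 (expr y g) := by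
  rw [leAt, RatCode.le_iff, auxs_code, ← h.value_evalCode, ← h.value_evalCode]
  norm_cast

theorem Denotes.level_eq (h : A.Denotes x σ) :
    ITACode.level A.code x.1 = (A.level σ.1).val := by
  rw [h.1, level_code]

theorem Denotes.isValid_iff (h : A.Denotes x σ) : isValid A.code x = true ↔ A.ZeroAbove σ := by
  have hm : A.code.2.1 = m := rfl
  simp only [isValid, h.level_eq, auxs_code, Bool.and_eq_true, List.all_eq_true, forall_mem_clocks,
    Bool.or_eq_true, decide_eq_true_eq, RatCode.isZero_iff, hm]
  rw [and_iff_right (h.1 ▸ σ.1.2)]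
  refine forall_congr' fun z => ?_
  rw [h.2 z, Rat.cast_eq_zero, or_iff_not_imp_left, not_le]
  rfl

theorem exists_denotes_of_isValid (h : isValid A.code x = true) :
    ∃ σ, A.Denotes x σ ∧ A.ZeroAbove σ := by
  have hx : x.1 < m := by
    simp only [isValid, Bool.and_eq_true, decide_eq_true_eq] at h
    exact h.1
  have hd : A.Denotes x (⟨x.1, hx⟩, fun z => ((coef x.2 (pos z)).value : ℝ)) :=
    ⟨rfl, fun _ => rfl⟩
  exact ⟨_, hd, hd.isValid_iff.1 h⟩

theorem holdsCode_iff (o : Cmp) (r : RatCode) :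
    Cmp.holdsCode o.code r = true ↔ o.holds (r.value : ℝ) := by
  have h0 : RatCode.value (0, 1) = 0 := by simp [RatCode.value]
  have h1 : RatCode.le r (0, 1) = true ↔ r.value ≤ 0 := by
    rw [RatCode.le_iff, h0]
  have h2 : RatCode.le (0, 1) r = true ↔ 0 ≤ r.value := by
    rw [RatCode.le_iff, h0]
  cases o
  · simp [Cmp.holdsCode, Cmp.code, Cmp.holds, ← not_le, ← h1]
  · simp [Cmp.holdsCode, Cmp.code, Cmp.holds, h2]
  · simp [Cmp.holdsCode, Cmp.code, Cmp.holds, h1, h2, ← le_antisymm_iff]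
  · simp [Cmp.holdsCode, Cmp.code, Cmp.holds, h1]
  · simp [Cmp.holdsCode, Cmp.code, Cmp.holds, ← not_le, ← h2]

theorem Denotes.isEnabled_iff (h : A.Denotes x σ)
    (e : Transition (Fin s) (Fin m) (Clock fun i : Fin n => Fin (y i))) :
    isEnabled A.code e.code x = true ↔ A.Enabled e σ := by
  simp only [isEnabled, Enabled, Transition.code, h.1, Bool.and_eq_true, decide_eq_true_eq,
    List.all_map, List.all_eq_true, Fin.val_inj, Function.comp, auxs_code, holdsCode_iff,
    h.value_evalCode, expr_linCode]

theorem Denotes.fire (h : A.Denotes x σ)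
    (e : Transition (Fin s) (Fin m) (Clock fun i : Fin n => Fin (y i))) :
    A.Denotes (ITACode.fire A.code e.code x) (A.fire e σ) := by
  refine ⟨rfl, fun z => ?_⟩
  simp only [ITACode.fire, auxs_code, coef_tabulate, h.value_evalCode]
  exact congrArg (eval σ.2) (congrFun (entry_update_code e) z).symm

theorem denotes_initConfig : A.Denotes (ITACode.initConfig A.code) A.initConfig := by
  refine ⟨rfl, fun z => ?_⟩
  simp [ITACode.initConfig, coef, RatCode.value, ITA.initConfig]

theorem Denotes.represents (hS : A.Lists S) (h : A.Denotes x σ) :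
    (classCode A.code S x).Represents (A.classOf σ) := by
  refine ⟨h.1, fun k hk C C' => ?_⟩
  have hk' : k.val < (A.level σ.1).val + 1 := Nat.lt_succ_of_le hk
  rw [classCode, h.level_eq, getD_map_range _ hk']
  simp only [List.mem_flatMap, List.mem_map, List.mem_filter, h.leAt_iff]
  constructor
  · rintro ⟨_, ⟨f, hf, g, ⟨hg, hle⟩, rfl⟩, rfl, rfl⟩
    exact ⟨hS.saturated hf, hS.saturated hg, hle⟩
  · rintro ⟨hC, hC', hle⟩
    obtain ⟨f, hf, rfl⟩ := hS.exists_code hC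
    obtain ⟨g, hg, rfl⟩ := hS.exists_code hC'
    exact ⟨(f, g), ⟨f, hf, g, ⟨hg, hle⟩, rfl⟩, rfl, rfl⟩

theorem represents_unique {c : ClassCode} {R R' : A.Class} (h : c.Represents R)
    (h' : c.Represents R') : R = R' := by
  refine Class.ext_le (Fin.ext (h.1.symm.trans h'.1)) fun k hk hk' f g => ?_
  have := (h.2 k hk f.1 g.1).symm.trans (h'.2 k hk' f.1 g.1)
  constructor
  · intro hle
    obtain ⟨_, _, h⟩ := this.1 ⟨f.2, g.2, hle⟩
    exact h
  · intro hle
    obtain ⟨_, _, h⟩ := this.2 ⟨f.2, g.2, hle⟩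
    exact h

/-- For a given list `S`, the code of a class does not depend on the configuration that represents
it, so that codes of classes can be compared literally. -/
theorem classCode_congr (hS : A.Lists S) (h : A.Denotes x σ) (h' : A.Denotes x' σ')
    (hσ : A.classOf σ = A.classOf σ') : classCode A.code S x = classCode A.code S x' := by
  have hst : σ.1 = σ'.1 := congrArg Class.state hσ
  have hx : x.1 = x'.1 := by rw [h.1, h'.1, hst]
  refine Prod.ext hx ?_
  simp only [classCode]
  rw [h.level_eq, h'.level_eq, ← hst]
  refine List.map_congr_left fun k hk => ?_
  have hk : k < (A.level σ.1).val + 1 := List.mem_range.1 hk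
  have hkn : k < n := by have := (A.level σ.1).2; omega
  obtain ⟨k, rfl⟩ : ∃ k' : Fin n, k'.val = k := ⟨⟨k, hkn⟩, rfl⟩
  refine List.flatMap_congr fun f hf => ?_
  refine congrArg _ (List.filter_congr fun g hg => ?_)
  rw [Bool.eq_iff_iff, h.leAt_iff, h'.leAt_iff]
  exact classOf_le_iff hσ (Nat.lt_succ_iff.1 hk) (hS.saturated hf) (hS.saturated hg)

set_option synthInstance.maxSize 2000 in
theorem Denotes.sameClass_iff (hS : A.Lists S) (h : A.Denotes x σ) (h' : A.Denotes x' σ') :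
    sameClass A.code S x x' = true ↔ A.classOf σ = A.classOf σ' := by
  refine decide_eq_true_iff.trans ?_
  refine ⟨fun hc => represents_unique (h.represents hS) ?_, classCode_congr hS h h'⟩
  rw [hc]
  exact h'.represents hS

theorem Denotes.postLeAt_iff (hS : A.Lists S) (h : A.Denotes x σ) (f g : A.E (A.level σ.1))
    {cf cg : LinCode} (hf : expr y cf = f.1) (hg : expr y cg = g.1) :
    postLeAt A.code (atLevel S (A.level σ.1).val) x
        (varCode (List.ofFn y) (ITACode.actClock A.code x.1)) cf cg = true ↔
      postLE (fun f g : A.E (A.level σ.1) => eval σ.2 f.1 ≤ eval σ.2 g.1) (A.actElem σ.1) f g := by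
  have ha : expr y (varCode (List.ofFn y) (ITACode.actClock A.code x.1)) = (A.actElem σ.1).1 := by
    rw [h.1, actClock_code, expr_varCode]
    rfl
  set a := A.actElem σ.1
  set ca := varCode (List.ofFn y) (ITACode.actClock A.code x.1)
  have htied : ((atLevel S (A.level σ.1).val).any fun h =>
      !same (auxs A.code) h ca && (leAt A.code x h ca && leAt A.code x ca h)) = true ↔
      ∃ h : A.E (A.level σ.1), h ≠ a ∧ eval σ.2 h.1 ≤ eval σ.2 a.1 ∧
        eval σ.2 a.1 ≤ eval σ.2 h.1 := by
    simp only [List.any_eq_true, Bool.and_eq_true, Bool.not_eq_true', ← Bool.not_eq_true,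
      auxs_code, same_iff, h.leAt_iff, ha, ne_eq, Subtype.ext_iff]
    exact hS.exists_iff (P := fun C => ¬ C = a.1 ∧ eval σ.2 C ≤ eval σ.2 a.1 ∧
      eval σ.2 a.1 ≤ eval σ.2 C)
  have hall : ((atLevel S (A.level σ.1).val).all fun h =>
      leAt A.code x h ca || leAt A.code x cf h) = true ↔
      ∀ h : A.E (A.level σ.1), ¬ eval σ.2 h.1 ≤ eval σ.2 a.1 → eval σ.2 f.1 ≤ eval σ.2 h.1 := by
    simp only [List.all_eq_true, Bool.or_eq_true, h.leAt_iff, ha, hf, or_iff_not_imp_left]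
    exact hS.forall_iff (P := fun C => ¬ eval σ.2 C ≤ eval σ.2 a.1 → eval σ.2 f.1 ≤ eval σ.2 C)
  unfold postLeAt postLE
  by_cases ht : ∃ h : A.E (A.level σ.1), h ≠ a ∧ eval σ.2 h.1 ≤ eval σ.2 a.1 ∧
        eval σ.2 a.1 ≤ eval σ.2 h.1
  · rw [htied.2 ht, cond_true]
    simp only [ht, not_true, false_and, or_false, true_and]
    simp only [Bool.and_eq_true, Bool.not_eq_true', ← Bool.not_eq_true,
      auxs_code, same_iff, h.leAt_iff, ha, hf, hg, ne_eq, Subtype.ext_iff]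
  · rw [Bool.eq_false_iff.2 ((not_congr htied).2 ht), cond_false]
    simp only [ht, not_false_eq_true, false_and, false_or, true_and]
    simp only [Bool.and_eq_true, Bool.or_eq_true, Bool.not_eq_true', ← Bool.not_eq_true, hall,
      auxs_code, same_iff, h.leAt_iff, ha, hf, hg, Subtype.ext_iff]

theorem Denotes.isTimeSucc_iff (hS : A.Lists S) (h : A.Denotes x σ) (h' : A.Denotes x' σ') :
    isTimeSucc A.code S x x' = true ↔ (A.classOf σ).TimeSucc (A.classOf σ') := by
  have hst : x'.1 = x.1 ↔ σ'.1 = σ.1 := by rw [h.1, h'.1, Fin.val_inj]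
  simp only [isTimeSucc, Bool.and_eq_true, decide_eq_true_eq, List.all_eq_true, hst, h.level_eq,
    List.mem_range, auxs_code]
  refine and_congr_right fun hσ => and_congr ?_ ?_
  · constructor
    · intro hlow k hk hk' f g hlt
      obtain ⟨cf, hcf, hf⟩ := hS.exists_code f.2
      obtain ⟨cg, hcg, hg⟩ := hS.exists_code g.2
      have := hlow k.val hlt cf hcf cg hcg
      rw [Bool.eq_iff_iff, h.leAt_iff, h'.leAt_iff, hf, hg] at this
      exact this
    · intro hlow k hk f hf g hg
      have hkn : k < n := hk.trans (A.level σ.1).2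
      obtain ⟨k, rfl⟩ : ∃ k' : Fin n, k'.val = k := ⟨⟨k, hkn⟩, rfl⟩
      rw [Bool.eq_iff_iff, h.leAt_iff, h'.leAt_iff]
      have hk1 : k ≤ A.level σ.1 := le_of_lt (Fin.lt_def.2 hk)
      exact hlow k hk1 (by rw [show (A.classOf σ').state = σ.1 from hσ]; exact hk1)
        ⟨_, hS.saturated hf⟩ ⟨_, hS.saturated hg⟩ hk
  · constructor
    · intro htop hk' f g
      obtain ⟨cf, hcf, hf⟩ := hS.exists_code f.2
      obtain ⟨cg, hcg, hg⟩ := hS.exists_code g.2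
      have := htop cf hcf cg hcg
      rw [Bool.eq_iff_iff, h'.leAt_iff, h.postLeAt_iff hS f g hf hg, hf, hg] at this
      exact this
    · intro htop f hf g hg
      rw [Bool.eq_iff_iff, h'.leAt_iff,
        h.postLeAt_iff hS ⟨_, hS.saturated hf⟩ ⟨_, hS.saturated hg⟩ rfl rfl]
      exact htop (by rw [show (A.classOf σ').state = σ.1 from hσ]; exact le_rfl)
        ⟨_, hS.saturated hf⟩ ⟨_, hS.saturated hg⟩

end ITA

/-! ### Correctness of the search -/

namespace ITA

open LinExpr LinCode ITACode

variable {s m n : ℕ} {y : Fin n → ℕ} {A : ITA (Fin s) (Fin m) fun i : Fin n => Fin (y i)}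
  {S : List (ℕ × LinCode)} {L : List ConfigCode}

theorem getD_trans_code (e : Fin A.trans.length) :
    (ITACode.trans A.code).getD e.val (0, [], none, [], 0) = A.trans[e].code := by
  simp [List.getD_eq_getElem?_getD]

/-- What a successful test of completeness says about the denoted configurations. -/
theorem isComplete_iff : isComplete A.code S L = true ↔
    ∀ x ∈ L, ∃ σ, A.Denotes x σ ∧ A.ZeroAbove σ ∧
      (∃ x' ∈ L, isTimeSucc A.code S x x' = true) ∧
      ∀ e ∈ A.trans, A.Enabled e σ →
        ∃ x' ∈ L, sameClass A.code S (ITACode.fire A.code e.code x) x' = true := by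
  simp only [isComplete, List.all_eq_true, Bool.and_eq_true, List.any_eq_true, trans_code,
    List.forall_mem_map, Bool.or_eq_true]
  refine forall₂_congr fun x _ => ?_
  constructor
  · rintro ⟨hv, ht, hd⟩
    obtain ⟨σ, hσ, h0⟩ := exists_denotes_of_isValid hv
    refine ⟨σ, hσ, h0, ht, fun e he hen => (hd e he).resolve_left ?_⟩
    rw [(hσ.isEnabled_iff e).2 hen]
    simp
  · rintro ⟨σ, hσ, h0, ht, hd⟩
    refine ⟨hσ.isValid_iff.2 h0, ht, fun e he => ?_⟩
    by_cases hen : A.Enabled e σ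
    · exact Or.inr (hd e he hen)
    · left
      rw [← hσ.isEnabled_iff e, Bool.not_eq_true] at hen
      simp [hen]

theorem exists_denotes_of_isComplete (hL : isComplete A.code S L = true)
    {x : ConfigCode} (hx : x ∈ L) : ∃ σ, A.Denotes x σ ∧ A.ZeroAbove σ := by
  obtain ⟨σ, h1, h2, -⟩ := isComplete_iff.1 hL x hx
  exact ⟨σ, h1, h2⟩

theorem Denotes.unique {x : ConfigCode} {σ σ' : A.Config} (h : A.Denotes x σ)
    (h' : A.Denotes x σ') : σ = σ' :=
  Prod.ext (Fin.ext (h.1.symm.trans h'.1)) (funext fun z => (h.2 z).trans (h'.2 z).symm)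

/-- A complete list that contains the initial configuration represents all accessible classes. -/
theorem exists_mem_of_accessible (hS : A.Lists S) (hL : isComplete A.code S L = true)
    (hinit : ITACode.initConfig A.code ∈ L) {R : A.Class} (hR : R.Accessible) :
    ∃ x ∈ L, ∃ σ, A.Denotes x σ ∧ A.ZeroAbove σ ∧ R = A.classOf σ := by
  obtain ⟨R₀, hR₀, hpath⟩ := hR
  induction hpath with
  | refl =>
    obtain ⟨h0, rfl⟩ := mem_sem_iff.1 hR₀
    exact ⟨_, hinit, _, denotes_initConfig, h0, rfl⟩
  | @tail R₁ R₂ _ hedge ih =>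
    obtain ⟨x, hx, σ, hσ, h0, rfl⟩ := ih
    obtain ⟨σ₁, hσ₁, -, ⟨x', hx', ht⟩, hd⟩ := isComplete_iff.1 hL x hx
    obtain rfl := hσ.unique hσ₁
    obtain ⟨_ | e, hedge⟩ := hedge
    · obtain ⟨σ', hσ', h0'⟩ := exists_denotes_of_isComplete hL hx'
      exact ⟨x', hx', σ', hσ', h0', hedge.unique ((hσ.isTimeSucc_iff hS hσ').1 ht)⟩
    · obtain ⟨hen, rfl⟩ := (discreteEdge_classOf_iff h0).1 hedge
      obtain ⟨x', hx', hs⟩ := hd _ (List.getElem_mem _) hen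
      obtain ⟨σ', hσ', h0'⟩ := exists_denotes_of_isComplete hL hx'
      exact ⟨x', hx', σ', hσ', h0', ((hσ.fire _).sameClass_iff hS hσ').1 hs⟩

theorem mem_edgeList_none {c c' : ClassCode} : (c, none, c') ∈ edgeList A.code S L ↔
    ∃ x ∈ L, ∃ x' ∈ L, isTimeSucc A.code S x x' = true ∧ c = classCode A.code S x ∧
      c' = classCode A.code S x' := by
  simp only [edgeList, List.mem_flatMap, List.mem_append, List.mem_map, Prod.mk.injEq,
    reduceCtorEq, false_and, and_false, exists_false, or_false]
  refine exists_congr fun x => and_congr_right fun _ => exists_congr fun x' =>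
    and_congr_right fun _ => ?_
  cases isTimeSucc A.code S x x' <;> simp

theorem mem_edgeList_some {c c' : ClassCode} {e : ℕ} :
    (c, some e, c') ∈ edgeList A.code S L ↔
    ∃ x ∈ L, ∃ x' ∈ L, ∃ he : e < A.trans.length, isEnabled A.code A.trans[e].code x = true ∧
      sameClass A.code S (ITACode.fire A.code A.trans[e].code x) x' = true ∧
      c = classCode A.code S x ∧ c' = classCode A.code S x' := by
  simp only [edgeList, List.mem_flatMap, List.mem_append, List.mem_map, Prod.mk.injEq,
    List.mem_filter, List.mem_range, Bool.and_eq_true, Option.some.injEq, trans_code,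
    List.length_map]
  refine exists_congr fun x => and_congr_right fun _ => exists_congr fun x' =>
    and_congr_right fun _ => ?_
  constructor
  · rintro (h | ⟨e', ⟨he, h1, h2⟩, rfl, rfl, rfl⟩)
    · cases hb : isTimeSucc A.code S x x' <;> simp [hb] at h
    · have := getD_trans_code (A := A) ⟨e', he⟩
      simp only [trans_code] at this
      rw [this] at h1 h2
      exact ⟨he, h1, h2, rfl, rfl⟩
  · rintro ⟨he, h1, h2, rfl, rfl⟩
    have := getD_trans_code (A := A) ⟨e, he⟩
    simp only [trans_code] at this
    exact Or.inr ⟨e, ⟨he, by rw [this]; exact ⟨h1, h2⟩⟩, rfl, rfl, rfl⟩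

theorem output_represents (hS : A.Lists S) (hL : isComplete A.code S L = true)
    (hinit : ITACode.initConfig A.code ∈ L) : (output A.code S L).Represents A := by
  have hden : ∀ x ∈ L, ∃ σ, A.Denotes x σ ∧ A.ZeroAbove σ := fun x hx =>
    exists_denotes_of_isComplete hL hx
  have hrep : ∀ {x σ} {R : A.Class}, A.Denotes x σ → (classCode A.code S x).Represents R →
      R = A.classOf σ := fun hσ hR => represents_unique hR (hσ.represents hS)
  have hmem : ∀ c, c ∈ (output A.code S L).1 ↔ ∃ x ∈ L, classCode A.code S x = c :=
    fun c => List.mem_map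
  have hlabel : ∀ l : Option ℕ, ∀ c c', (c, l, c') ∈ edgeList A.code S L →
      ∃ l' : Option (Fin A.trans.length), l = l'.map Fin.val := by
    rintro (_ | e) c c' h
    · exact ⟨none, rfl⟩
    · obtain ⟨_, _, _, _, he, _⟩ := mem_edgeList_some.1 h
      exact ⟨some ⟨e, he⟩, rfl⟩
  constructor
  · intro c hc
    obtain ⟨x, hx, rfl⟩ := (hmem c).1 hc
    obtain ⟨σ, hσ, -⟩ := hden x hx
    exact ⟨_, hσ.represents hS⟩
  -- Equal classes have equal codes, even if `L` contains several representatives.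
  · intro c hc c' hc' R hR hR'
    obtain ⟨x, hx, rfl⟩ := (hmem c).1 hc
    obtain ⟨x', hx', rfl⟩ := (hmem c').1 hc'
    obtain ⟨σ, hσ, -⟩ := hden x hx
    obtain ⟨σ', hσ', -⟩ := hden x' hx'
    exact classCode_congr hS hσ hσ' ((hrep hσ hR).symm.trans (hrep hσ' hR'))
  · intro R hR
    obtain ⟨x, hx, σ, hσ, -, rfl⟩ := exists_mem_of_accessible hS hL hinit hR
    exact ⟨_, (hmem _).2 ⟨x, hx, rfl⟩, hσ.represents hS⟩
  · exact ⟨(hmem _).2 ⟨_, hinit, rfl⟩, _, denotes_initConfig.represents hS,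
      mem_sem_iff.2 ⟨zeroAbove_initConfig, rfl⟩⟩
  · intro c hc
    obtain ⟨x, hx, rfl⟩ := List.mem_map.1 hc
    exact (hmem _).2 ⟨x, (List.mem_filter.1 hx).1, rfl⟩
  · intro c hc R hR
    obtain ⟨x, hx, rfl⟩ := (hmem c).1 hc
    obtain ⟨σ, hσ, -⟩ := hden x hx
    obtain rfl := hrep hσ hR
    refine ⟨fun h => ?_, fun h => ?_⟩
    · obtain ⟨x', hx', heq⟩ := List.mem_map.1 h
      obtain ⟨-, hf⟩ := List.mem_filter.1 hx'
      have hxx : x'.1 = σ.1.val := (congrArg Prod.fst heq).trans hσ.1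
      rw [hxx, isFinal_code] at hf
      exact hf
    · refine List.mem_map.2 ⟨x, List.mem_filter.2 ⟨hx, ?_⟩, rfl⟩
      rw [hσ.1, isFinal_code]
      exact h
  · rintro ⟨c, l, c'⟩ ht
    refine ⟨?_, ?_, hlabel l c c' ht⟩ <;> rcases l with _ | e
    · obtain ⟨x, hx, x', hx', -, rfl, rfl⟩ := mem_edgeList_none.1 ht
      exact (hmem _).2 ⟨x, hx, rfl⟩
    · obtain ⟨x, hx, x', hx', -, -, -, rfl, rfl⟩ := mem_edgeList_some.1 ht
      exact (hmem _).2 ⟨x, hx, rfl⟩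
    · obtain ⟨x, hx, x', hx', -, rfl, rfl⟩ := mem_edgeList_none.1 ht
      exact (hmem _).2 ⟨x', hx', rfl⟩
    · obtain ⟨x, hx, x', hx', -, -, -, rfl, rfl⟩ := mem_edgeList_some.1 ht
      exact (hmem _).2 ⟨x', hx', rfl⟩
  · intro c hc c' hc' R R' hR hR' l
    rcases l with _ | e
    · refine mem_edgeList_none.trans ⟨?_, fun h => ?_⟩
      · rintro ⟨x, hx, x', hx', ht, rfl, rfl⟩
        obtain ⟨σ, hσ, -⟩ := hden x hx
        obtain ⟨σ', hσ', -⟩ := hden x' hx'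
        obtain rfl := hrep hσ hR
        obtain rfl := hrep hσ' hR'
        exact (hσ.isTimeSucc_iff hS hσ').1 ht
      · obtain ⟨x, hx, rfl⟩ := (hmem c).1 hc
        obtain ⟨x', hx', rfl⟩ := (hmem c').1 hc'
        obtain ⟨σ, hσ, -⟩ := hden x hx
        obtain ⟨σ', hσ', -⟩ := hden x' hx'
        obtain rfl := hrep hσ hR
        obtain rfl := hrep hσ' hR'
        exact ⟨x, hx, x', hx', (hσ.isTimeSucc_iff hS hσ').2 h, rfl, rfl⟩
    · refine mem_edgeList_some.trans ⟨?_, fun h => ?_⟩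
      · rintro ⟨x, hx, x', hx', he, hen, hs, rfl, rfl⟩
        obtain ⟨σ, hσ, h0⟩ := hden x hx
        obtain ⟨σ', hσ', -⟩ := hden x' hx'
        obtain rfl := hrep hσ hR
        obtain rfl := hrep hσ' hR'
        exact (discreteEdge_classOf_iff h0).2 ⟨(hσ.isEnabled_iff _).1 hen,
          (((hσ.fire _).sameClass_iff hS hσ').1 hs).symm⟩
      · obtain ⟨x, hx, rfl⟩ := (hmem c).1 hc
        obtain ⟨x', hx', rfl⟩ := (hmem c').1 hc'
        obtain ⟨σ, hσ, h0⟩ := hden x hx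
        obtain ⟨σ', hσ', -⟩ := hden x' hx'
        obtain rfl := hrep hσ hR
        obtain rfl := hrep hσ' hR'
        obtain ⟨hen, heq⟩ := (discreteEdge_classOf_iff h0).1 h
        exact ⟨x, hx, x', hx', e.2, (hσ.isEnabled_iff _).2 hen,
          ((hσ.fire _).sameClass_iff hS hσ').2 heq.symm, rfl, rfl⟩

theorem lists_saturate {N : ℕ} (h : isClosed A.code (saturate A.code N) = true) :
    A.Lists (saturate A.code N) :=
  ⟨sound_saturate N, fun _ _ hC => complete_of_isClosed h hC⟩

/-- Every automaton found by the search is the class automaton. -/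
theorem candidate_represents {p : ℕ × List ConfigCode} {B : ClassAutomatonCode}
    (h : candidate A.code p = some B) : B.Represents A := by
  unfold candidate at h
  cases hb : isClosed A.code (saturate A.code p.1) && isComplete A.code (saturate A.code p.1)
    (ITACode.initConfig A.code :: p.2) with
  | false => simp [hb] at h
  | true =>
    rw [hb, cond_true, Option.some.injEq] at h
    subst h
    rw [Bool.and_eq_true] at hb
    exact output_represents (lists_saturate hb.1) hb.2 List.mem_cons_self

/-! ### Rational representatives of the accessible classes -/

/-- A configuration with rational values has a code. -/
theorem exists_denotes_of_rational {σ : A.Config}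
    (h : ∀ z, σ.2 z ∈ (Rat.castHom ℝ).fieldRange) : ∃ x, A.Denotes x σ := by
  choose q hq using fun z => RingHom.mem_fieldRange.1 (h z)
  refine ⟨(σ.1.val, clockFamilyCode fun z => ratCode (q z)), rfl, fun z => ?_⟩
  simp [← hq]

/-- Time successors and discrete edges lead from rational configurations to rational ones, so that
every accessible class contains a rational configuration. -/
theorem exists_rational_of_accessible {R : A.Class} (hR : R.Accessible) :
    ∃ σ : A.Config, (∀ z, σ.2 z ∈ (Rat.castHom ℝ).fieldRange) ∧ A.ZeroAbove σ ∧
      R = A.classOf σ := by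
  set K := (Rat.castHom ℝ).fieldRange
  obtain ⟨R₀, hR₀, hpath⟩ := hR
  induction hpath with
  | refl => exact ⟨A.initConfig, fun _ => K.zero_mem, mem_sem_iff.1 hR₀⟩
  | @tail R₁ R₂ _ hedge ih =>
    obtain ⟨σ, hK, h0, rfl⟩ := ih
    obtain ⟨_ | e, hedge⟩ := hedge
    · obtain ⟨d, -, hd, hsucc⟩ := exists_delay_timeSucc σ K hK
      refine ⟨A.delay σ d, fun z => ?_, zeroAbove_delay h0 d, hedge.unique hsucc⟩
      by_cases hz : z = A.actClock σ.1
      · subst hz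
        simpa [delay] using K.add_mem (hK _) hd
      · simpa [delay, hz] using hK z
    · obtain ⟨hen, rfl⟩ := (discreteEdge_classOf_iff h0).1 hedge
      exact ⟨_, fun z => eval_mem _ K hK _, zeroAbove_fire (List.getElem_mem _) hen.1 h0, rfl⟩

theorem accessible_initial : (A.classOf A.initConfig).Accessible :=
  ⟨_, mem_sem_iff.2 ⟨zeroAbove_initConfig, rfl⟩, .refl⟩

theorem Class.Accessible.edge {R R' : A.Class} (h : R.Accessible)
    {l : Option (Fin A.trans.length)} (hl : Class.edge l R R') : R'.Accessible := by
  obtain ⟨R₀, h0, hpath⟩ := h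
  exact ⟨R₀, h0, hpath.tail ⟨l, hl⟩⟩

variable (A) in
/-- The search succeeds: finitely many rational configurations represent the accessible classes. -/
theorem exists_candidate : ∃ p, (candidate A.code p).isSome := by
  obtain ⟨N, hN⟩ := exists_isClosed_saturate A
  have hS := lists_saturate hN
  have hrep : ∀ R : {R : A.Class // R.Accessible}, ∃ x σ, A.Denotes x σ ∧ A.ZeroAbove σ ∧
      R.1 = A.classOf σ := by
    rintro ⟨R, hR⟩
    obtain ⟨σ, hK, h0, h⟩ := exists_rational_of_accessible hR
    obtain ⟨x, hx⟩ := exists_denotes_of_rational hK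
    exact ⟨x, σ, hx, h0, h⟩
  choose rep conf hden hzero hclass using hrep
  have := Fintype.ofFinite {R : A.Class // R.Accessible}
  set L := ITACode.initConfig A.code ::
    (Finset.univ : Finset {R : A.Class // R.Accessible}).toList.map rep
  have hmem : ∀ R, rep R ∈ L := fun R =>
    List.mem_cons_of_mem _ (List.mem_map.2 ⟨R, by simp, rfl⟩)
  have hL : ∀ x ∈ L, ∃ σ, A.Denotes x σ ∧ A.ZeroAbove σ ∧ (A.classOf σ).Accessible := by
    intro x hx
    rcases List.mem_cons.1 hx with rfl | hx
    · exact ⟨_, denotes_initConfig, zeroAbove_initConfig, accessible_initial⟩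
    · obtain ⟨R, -, rfl⟩ := List.mem_map.1 hx
      exact ⟨conf R, hden R, hzero R, hclass R ▸ R.2⟩
  have hcomplete : isComplete A.code (saturate A.code N) L = true := by
    refine isComplete_iff.2 fun x hx => ?_
    obtain ⟨σ, hσ, h0, hacc⟩ := hL x hx
    refine ⟨σ, hσ, h0, ?_, fun e he hen => ?_⟩
    · obtain ⟨d, -, -, hsucc⟩ := exists_delay_timeSucc σ ⊤ (fun _ => trivial)
      have hacc' := hacc.edge (l := none) hsucc
      refine ⟨_, hmem ⟨_, hacc'⟩, (hσ.isTimeSucc_iff hS (hden _)).2 ?_⟩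
      rw [← hclass]
      exact hsucc
    · obtain ⟨i, hi, rfl⟩ := List.mem_iff_getElem.1 he
      have hacc' := hacc.edge (l := some ⟨i, hi⟩)
        ((discreteEdge_classOf_iff h0).2 ⟨hen, rfl⟩)
      exact ⟨_, hmem ⟨_, hacc'⟩, ((hσ.fire _).sameClass_iff hS (hden _)).2 (hclass ⟨_, hacc'⟩)⟩
  refine ⟨(N, (Finset.univ : Finset {R : A.Class // R.Accessible}).toList.map rep), ?_⟩
  unfold candidate
  rw [hN, Bool.true_and, hcomplete]
  rfl

end ITA

theorem mainTheorem1 :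
    (∀ (Act : Type*) (Q : Type*) [Finite Act] [Finite Q] (n : ℕ) (Y : Fin n → Type*)
        [∀ i, Fintype (Y i)] (A : ITA Act Q Y),
      -- the untimed language is regular
      A.untimedLanguage.IsRegular ∧
      -- the saturated sets and the class automaton are finite
      (∀ k, (A.E k).Finite) ∧
      Finite A.Class ∧
      -- there is exactly one initial class
      (∃! R₀ : A.Class, A.initConfig ∈ R₀.sem) ∧
      -- the class automaton is time-abstract bisimilar to the transition system
      IsBisimulation A.abstractStep ITA.Class.abstractStep
        (fun (s : A.Config) (R : A.Class) => s ∈ R.sem) ∧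
      -- the class automaton accepts the untimed language
      A.classAutomaton.accepts = A.untimedLanguage) ∧
    -- there is an algorithm that builds the class automaton
    ∃ build : ITACode →. ClassAutomatonCode, Partrec build ∧
      ∀ (s m n : ℕ) (y : Fin n → ℕ) (A : ITA (Fin s) (Fin m) fun i : Fin n => Fin (y i)),
        ∃ B ∈ build A.code, B.Represents A := by
  refine ⟨fun Act Q _ _ n Y _ A => ⟨A.isRegular_untimedLanguage, ITA.finite_E, inferInstance,
    ITA.existsUnique_initial, A.isBisimulation_sem, A.accepts_classAutomaton⟩,
    ITACode.build, ITACode.partrec_build, fun s m n y A => ?_⟩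
  obtain ⟨p, hp⟩ := A.exists_candidate
  obtain ⟨q, B, hq, hB⟩ := ITACode.mem_build_of_candidate hp
  exact ⟨B, hB, ITA.candidate_represents hq⟩
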